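/- **Setting.** Let $\tau$ be conjugation by $\mathrm{diag}(1,-1)$ on complex $2\times 2$ matrices, and let $\langle X,Y\rangle=4\,\mathrm{tr}(XY)$ be the Killing form of $\mathfrak{sl}(2,\mathbb C)$. Let $\Lambda\mathrm{SU}(2)_\tau$ (resp. $\Lambda\mathfrak{su}(2)_\tau$) be the set of smooth maps $g$ from $S^1$ to $\mathrm{SU}(2)$ (resp. $\mathfrak{su}(2)$) with $g(-\lambda)=\tau g(\lambda)$. Let $\Lambda_+$ be the group of smooth $b:S^1\to \mathrm{SL}(2,\mathbb C)$ with $b(-\lambda)=\tau b(\lambda)$ which extend holomorphically to $|\lambda|<1$ (continuously up to $S^1$, with values in $\mathrm{SL}(2,\mathbb C)$) with $b(0)=\mathrm{diag}(r,r^{-1})$, $r>0$. A degree one potential is $\xi\,dz$ with $\xi=\lambda^{-1}\xi_-+\xi_0+\lambda\xi_+\in\Lambda\mathfrak{su}(2)_\tau$ and $\xi_-\neq0$. It generates $F:\mathbb C\to\Lambda\mathrm{SU}(2)_\tau$ if for every $z\in\mathbb C$ there is $b(z)\in\Lambda_+$ with $\exp(z\xi)=F(z)\,b(z)$. For $\mu\in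 S^1$ and a smooth loop $g$ put $\Phi_\mu(g)=(g,\,g'g^{-1})|_\mu\in \mathrm{SU}(2)\ltimes\mathfrak{su}(2)$, where $'$ is the derivative with respect to $t$, $\lambda=e^{it}$, and let $(g,\zeta)\cdot\eta=g\eta g^{-1}+\zeta$. Identify $\mathfrak{su}(2)$ with Euclidean $\mathbb R^3$ by the inner product $-\tfrac12\langle\,,\rangle$, oriented so that the Lie bracket is the cross product. Let $\mathrm e_1=\mathrm{diag}(\tfrac i2,-\tfrac i2)$. For $H\in\mathbb R\setminus\{0\}$ the Sym--Bobenko formula $$f^{\pm}_\lambda(z)=-\tfrac1{2H}\,\Phi_\lambda(F(z))\cdot(\mp \mathrm e_1)$$ defines the two (parallel) associated families of $F$. A Delaunay surface of mean curvature $H$ is an immersed surface $\mathbb C\to\mathbb R^3$ of constant mean curvature $H$ (for a suitable choice of unit normal) which is a surface of revolution: there is an axis such that each rotation about it maps the surface to itself, up to a diffeomorphism of the domain. **Theorem.** Let $\xi\,dz$ be a degree one potential with $\xi\in\Lambda_1\mathfrak{su}(2)_\tau$, $\xi_-\ne0$. Then it generates exactly one map $F$. This $F$ is an extended frame: $(z,\lambda)\mapsto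 F_\lambda(z)$ is smooth and $F_\lambda^{-1}dF_\lambda=\alpha_{\mathfrak k}+\lambda^{-1}\alpha'_{\mathfrak m}+\lambda\,\overline{\alpha'_{\mathfrak m}}$, where $\alpha_{\mathfrak k}$ is a $1$-form with values in the diagonal part of $\mathfrak{su}(2)$, $\alpha'_{\mathfrak m}$ is a $(1,0)$-form with values in the off-diagonal matrices, and the bar is conjugation with respect to $\mathfrak{su}(2)$. Moreover: 1. For all $H\ne0$, $\lambda\in S^1$, $x\in\mathbb R$, $z\in\mathbb C$ one has $f^\pm_\lambda(z+x)=-\tfrac1{2H}\,\Phi_\lambda(\exp(x\xi))\cdot\bigl(-2H f^{\pm}_\lambda(z)\bigr)$. 2. If $\mu\in S^1$, $\mu^4\langle\xi_+,\xi_+\rangle=\langle\xi_-,\xi_-\rangle$ and $\xi(\mu)\neq0$, then $x\mapsto\Phi_\mu(\exp(x\xi))$ acts on $\mathfrak{su}(2)\cong\mathbb R^3$ as the rotations about a fixed axis, with constant non-zero angular speed. 3. If $\langle\xi_-,\xi_-\rangle\neq0$, then exactly four points $\mu\in S^1$ satisfy $\mu^4=\langle\xi_-,\xi_-\rangle/\langle\xi_+,\xi_+\rangle$,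 and $\xi(\mu)\ne0$ for at least two of them. For every $H\neq0$ all the $f^+_\lambda$ and $f^-_\lambda$, $\lambda\in S^1$, are conformal immersions of constant mean curvature $H$; and at each of the four points $\mu$ both $f^+_\mu$ and $f^-_\mu$ are Delaunay surfaces of mean curvature $H$. 4. If $\langle\xi_-,\xi_-\rangle=0$, then for one choice of the sign, the same for all $H\ne0$ and all $\lambda\in S^1$, $f^{\pm}_\lambda$ is a conformally immersed Delaunay surface of mean curvature $H$, while for the opposite sign the map $f_\lambda^{\mp}$ is constant. In particular $\xi\,dz$ generates the associated family of a Delaunay surface. -/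

import Mathlib

open scoped ContDiff

noncomputable section

namespace DegreeOnePotential

/-! ### Loops with values in `2 × 2` matrices -/

/-- Complex `2 × 2` matrices, containing `SU(2)`, `SL(2, ℂ)`, `su(2)` and `sl(2, ℂ)`. -/
abbrev M2 : Type := Matrix (Fin 2) (Fin 2) ℂ

/-- Euclidean three-space. -/
abbrev E3 : Type := EuclideanSpace ℝ (Fin 3)

/-- The involution `τ`, conjugation by `diag (1, -1)`. Its fixed group in `SU(2)` is the group `K`
of diagonal matrices, and `SU(2) / K` is the two-sphere. -/
def tau (X : M2) : M2 := !![1, 0; 0, -1] * X * !![1, 0; 0, -1]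

/-- The Lie algebra `su(2)`. -/
def InSu2 (X : M2) : Prop := X.conjTranspose = -X ∧ X.trace = 0

/-- Smoothness of a loop, in the coordinate `t` with `λ = e ^ (i t)`. -/
def SmoothLoop (g : Circle → M2) : Prop :=
  ∀ i j, ContDiff ℝ ∞ (fun t : ℝ => g (Circle.exp t) i j)

/-- The twisting condition; `τ` has order two, so `ω = -1`. -/
def TwistedLoop (g : Circle → M2) : Prop :=
  ∀ l m : Circle, (m : ℂ) = -(l : ℂ) → g m = tau (g l)

/-- The twisted loop group `Λ SU(2)_τ`. -/
structure InLoopSU2 (g : Circle → M2) : Prop where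
  smooth : SmoothLoop g
  mem : ∀ l, g l ∈ Matrix.specialUnitaryGroup (Fin 2) ℂ
  twisted : TwistedLoop g

/-- The twisted loop algebra `Λ su(2)_τ`. -/
structure InLoopAlgebra (x : Circle → M2) : Prop where
  smooth : SmoothLoop x
  mem : ∀ l, InSu2 (x l)
  twisted : TwistedLoop x

/-- The group `Λ₊`: twisted smooth loops in `SL(2, ℂ)` that extend holomorphically to the unit disc,
with value at `0` in `B = {diag (r, r⁻¹) | r > 0}`. -/
structure InLoopPlus (b : Circle → M2) : Prop where
  smooth : SmoothLoop b
  det_eq_one : ∀ l, (b l).det = 1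
  twisted : TwistedLoop b
  extends_holomorphically : ∃ e : ℂ → M2,
    (∀ i j, DiffContOnCl ℂ (fun w => e w i j) (Metric.ball 0 1)) ∧
    (∀ w ∈ Metric.ball (0 : ℂ) 1, (e w).det = 1) ∧
    (∀ l : Circle, e l = b l) ∧
    ∃ r : ℝ, 0 < r ∧ e 0 = !![(r : ℂ), 0; 0, (r : ℂ)⁻¹]

/-- The loop `λ⁻¹ ξ₋ + ξ₀ + λ ξ₊`. -/
def laurentLoop (xm x0 xp : M2) (l : Circle) : M2 :=
  (l : ℂ)⁻¹ • xm + x0 + (l : ℂ) • xp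

/-- The pointwise exponential `exp (z ξ)` of a loop of matrices. -/
def expLoop (x : Circle → M2) (z : ℂ) (l : Circle) : M2 := NormedSpace.exp (z • x l)

/-- The potential `ξ dz` generates `F`: for every `z`, `F z` is the `Λ SU(2)_τ`-factor
of the Iwasawa decomposition `exp (z ξ) = F b`. -/
def Generates (x : Circle → M2) (F : ℂ → Circle → M2) : Prop :=
  ∀ z, InLoopSU2 (F z) ∧
    ∃ b : Circle → M2, InLoopPlus b ∧ ∀ l, expLoop x z l = F z l * b l

/-- The Killing form of `sl(2, ℂ)`. -/
def killing (X Y : M2) : ℂ := 4 * (X * Y).trace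

/-! ### Extended frames -/

/-- The directional derivative at `z`, in the direction `v`, of a matrix valued map on the plane. -/
def dirDeriv (G : ℂ → M2) (z v : ℂ) : M2 :=
  Matrix.of fun i j => fderiv ℝ (fun w => G w i j) z v

/-- `F` is an extended frame: a smooth map to `Λ SU(2)_τ` with
`F⁻¹ dF = α_k + λ⁻¹ α'_m + λ α''_m`. Here `α_k = a dx + b dy` has values in
the Lie algebra of `K`, `α'_m = P dz` has values in the complexified `(-1)`-eigenspace
of `τ`, and `α''_m` is its conjugate; conjugation on `sl(2, ℂ)` with respect to `su(2)` is
`P ↦ -Pᴴ`. -/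
structure IsExtendedFrame (F : ℂ → Circle → M2) : Prop where
  mem : ∀ z, InLoopSU2 (F z)
  smooth : ∀ i j, ContDiff ℝ ∞ (fun q : ℂ × ℝ => F q.1 (Circle.exp q.2) i j)
  form : ∃ a b P : ℂ → M2, ∀ z,
    (InSu2 (a z) ∧ tau (a z) = a z) ∧ (InSu2 (b z) ∧ tau (b z) = b z) ∧
    tau (P z) = -P z ∧
    ∀ l : Circle,
      (F z l)⁻¹ * dirDeriv (fun w => F w l) z 1 =
        a z + (l : ℂ)⁻¹ • P z + (l : ℂ) • (-(P z).conjTranspose) ∧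
      (F z l)⁻¹ * dirDeriv (fun w => F w l) z Complex.I =
        b z + (l : ℂ)⁻¹ • (Complex.I • P z) +
          (l : ℂ) • ((-Complex.I) • (-(P z).conjTranspose))

/-! ### The Euclidean group and the Sym--Bobenko formula -/

/-- The derivative of a loop at `μ` with respect to `t`, where `λ = e ^ (i t)`. -/
def loopDeriv (g : Circle → M2) (m : Circle) : M2 :=
  Matrix.of fun i j => deriv (fun t : ℝ => g (m * Circle.exp t) i j) 0

/-- The homomorphism `Φ_μ` from `Λ SU(2)_τ` to `SU(2) ⋉ su(2)`, `F ↦ (F, F' F⁻¹)` at `μ`. -/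
def Phi (m : Circle) (g : Circle → M2) : M2 × M2 := (g m, loopDeriv g m * (g m)⁻¹)

/-- The affine action `(g, ζ) · η = Ad g η + ζ` of `SU(2) ⋉ su(2)` on `su(2)`. -/
def affineAct (p : M2 × M2) (X : M2) : M2 := p.1 * X * p.1⁻¹ + p.2

/-- The unit vector `e₁ = diag (i / 2, -i / 2)`, which is fixed by `K`. -/
def e1 : M2 := !![Complex.I / 2, 0; 0, -Complex.I / 2]

/-- The Sym--Bobenko formula `f^ε_λ = -(1 / 2H) Φ_λ(F) · (-ε e₁)` as a map to `su(2)`;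
`ε = 1` gives `f⁺` and `ε = -1` gives `f⁻`. -/
def symBobenko (H ε : ℝ) (F : ℂ → Circle → M2) (l : Circle) (z : ℂ) : M2 :=
  (-(1 / (2 * H))) • affineAct (Phi l (F z)) ((-ε) • e1)

/-- Coordinates on `su(2)` in the basis `iσ₃/2, iσ₂/2, iσ₁/2`. It is orthonormal for `-1/2` times
the Killing form, and the Lie bracket becomes the cross product. -/
def toE3 (X : M2) : E3 := !₂[2 * (X 0 0).im, 2 * (X 0 1).re, 2 * (X 0 1).im]

/-- The surface `f^ε_λ` in Euclidean three-space. -/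
def surface (H ε : ℝ) (F : ℂ → Circle → M2) (l : Circle) (z : ℂ) : E3 :=
  toE3 (symBobenko H ε F l z)

/-! ### Surfaces in Euclidean three-space -/

/-- Partial derivatives with respect to `x` and `y`, where `z = x + i y`. -/
def dx (f : ℂ → E3) (z : ℂ) : E3 := fderiv ℝ f z 1

def dy (f : ℂ → E3) (z : ℂ) : E3 := fderiv ℝ f z Complex.I

/-- A smooth immersion of the plane. -/
def IsSmoothImmersion (f : ℂ → E3) : Prop :=
  ContDiff ℝ ∞ f ∧ ∀ z, Function.Injective (fderiv ℝ f z)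

def IsConformalMap (f : ℂ → E3) : Prop :=
  ∀ z, ‖dx f z‖ = ‖dy f z‖ ∧ inner ℝ (dx f z) (dy f z) = 0

/-- `f` has constant mean curvature `H` with respect to some smooth unit normal field `ν`:
in terms of the first and second fundamental forms, `e G - 2 f F + g E = 2 H (E G - F²)`. -/
def HasConstantMeanCurvature (H : ℝ) (f : ℂ → E3) : Prop :=
  ∃ ν : ℂ → E3, ContDiff ℝ ∞ ν ∧ ∀ z,
    ‖ν z‖ = 1 ∧ inner ℝ (ν z) (dx f z) = 0 ∧ inner ℝ (ν z) (dy f z) = 0 ∧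
    inner ℝ (dx (dx f) z) (ν z) * inner ℝ (dy f z) (dy f z)
        - 2 * inner ℝ (dy (dx f) z) (ν z) * inner ℝ (dx f z) (dy f z)
        + inner ℝ (dy (dy f) z) (ν z) * inner ℝ (dx f z) (dx f z)
      = 2 * H * (inner ℝ (dx f z) (dx f z) * inner ℝ (dy f z) (dy f z)
          - inner ℝ (dx f z) (dy f z) ^ 2)

/-- An immersed surface in three-space of constant mean curvature `H`. -/
def IsCMCSurface (H : ℝ) (f : ℂ → E3) : Prop :=
  IsSmoothImmersion f ∧ HasConstantMeanCurvature H f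

def cross (u v : E3) : E3 := WithLp.toLp 2 (crossProduct (WithLp.ofLp u) (WithLp.ofLp v))

/-- The rotation by the angle `θ` about the line through `p` with unit direction `d`. -/
def rotation (p d : E3) (θ : ℝ) (v : E3) : E3 :=
  p + Real.cos θ • (v - p) + Real.sin θ • cross d (v - p)
    + ((1 - Real.cos θ) * inner ℝ d (v - p)) • d

/-- A surface of revolution: there is an axis such that each rotation about it maps the
parametrised surface to itself, up to a diffeomorphism of the domain. -/
def IsSurfaceOfRevolution (f : ℂ → E3) : Prop :=
  ∃ p d : E3, ‖d‖ = 1 ∧ ∀ θ : ℝ, ∃ φ : ℂ ≃ ℂ,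
    ContDiff ℝ ∞ φ ∧ ContDiff ℝ ∞ φ.symm ∧ ∀ z, f (φ z) = rotation p d θ (f z)

/-- A Delaunay surface of mean curvature `H`: a surface of revolution of constant mean
curvature. -/
def IsDelaunaySurface (H : ℝ) (f : ℂ → E3) : Prop :=
  IsCMCSurface H f ∧ IsSurfaceOfRevolution f

/-- A one-parameter family in `SU(2) ⋉ su(2)` acts on `su(2) ≅ ℝ³` as the rotations about a fixed
axis, at constant non-zero angular speed. -/
def ActsByRotations (P : ℝ → M2 × M2) : Prop :=
  ∃ p d : E3, ∃ s : ℝ, ‖d‖ = 1 ∧ s ≠ 0 ∧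
    ∀ (x : ℝ) (X : M2), InSu2 X → toE3 (affineAct (P x) X) = rotation p d (s * x) (toE3 X)

end DegreeOnePotential

end

/-! Twisting and reality force `ξ = kf a b c`, that is `ξ₋ = offd a b`, `ξ₀ = dg c` and `ξ₊ = -ξ₋ᴴ`.
Write `z = x + iy`. For real `x` the loop `exp (xξ)` is already unitary, so the positive factor `B`
of `exp (zξ)` can be sought as a function of `y` alone, and the Iwasawa splitting becomes an
ordinary differential equation; no general factorisation theorem is needed.

The loop `η = B ξ B⁻¹ = F⁻¹ ξ F` is again of degree one. It obeys the Lax equation `η' = [iη₀ +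
2iλη₊, η]`, while `B' = (iη₀ + 2iλη₊) B`. In components, `α' = -2γα`, `β' = 2γβ`, `γ' = 2(|α|² -
|β|²)`. This quadratic field is tangent to spheres, hence complete (`exists_global_integral_curve`,
`exists_sinh_gordon`). Once `η` is known the equation for `B` is linear; with the diagonal part
removed it reads `C' = λNC` and is solved by a power series entire in `λ`
(`exists_smooth_linear_flow`). The map `F = exp (zξ) B⁻¹` satisfies `F⁻¹F_x = η` and `F⁻¹F_y = θ =
iλ⁻¹η₋ - iλη₊`. Both lie in `su(2)` on the circle, so `F` is unitary and an extended frame.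
Uniqueness is the maximum principle (`eq_one_of_inLoopPlus`).

Since `F(z + x) = exp (xξ) F(z)` and `Φ_μ` is a homomorphism, `ξ` generates a symmetry of every
surface of the family. If `⟨ξ, ξ'⟩ = 0` at `μ`, which is the quartic condition, and `ξ(μ) ≠ 0`, then
`ξ' = [Y, ξ]` for some `Y`, and the symmetry is rotation about the line through `Y` in the direction
`ξ(μ)` (`actsByRotations_kf`).

Differentiating the Sym--Bobenko formula, `f_x` has the coordinate `λ⁻¹β` for `f⁺` and `λᾱ` for `f⁻`
in the moving frame. As `α` and `β` are positive multiples of `a` and `b`, and `⟨ξ₋, ξ₋⟩ = 8ab`,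
either both surfaces are immersed, or one is and the other is constant. There remains a special
point with `ξ(μ) = 0`: there conservation of energy makes `η` constant, `F = exp (xξ + yθ)`, and `θ`
supplies the rotations instead (`frame_add_imaginary`). -/

open scoped ContDiff

noncomputable section

namespace DegreeOnePotential

/-! ### Two facts on ordinary differential equations -/

/-- A curve whose velocity is orthogonal to the position has constant norm. -/
lemma norm_eq_of_inner_velocity_eq_zero {E : Type*} [NormedAddCommGroup E] [InnerProductSpace ℝ E]
    {f f' : ℝ → E} {s : Set ℝ} (hs : Convex ℝ s)
    (hf : ∀ t ∈ s, HasDerivWithinAt f (f' t) s t) (h0 : ∀ t ∈ s, inner ℝ (f t) (f' t) = 0)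
    {a b : ℝ} (ha : a ∈ s) (hb : b ∈ s) : ‖f a‖ = ‖f b‖ := by
  have hd : ∀ t ∈ s, HasDerivWithinAt (fun t => ‖f t‖ ^ 2) 0 s t := by
    intro t ht
    simpa [h0 t ht] using (hf t ht).norm_sq
  have h1 : ‖f a‖ ^ 2 = ‖f b‖ ^ 2 := by
    have := hs.norm_image_sub_le_of_norm_hasDerivWithin_le (C := 0) hd (by simp) ha hb
    have h2 := norm_le_zero_iff.1 (by simpa using this)
    linarith
  exact (pow_left_inj₀ (norm_nonneg _) (norm_nonneg _) two_ne_zero).1 h1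

open Metric Set in
/-- A `C¹` vector field tangent to all spheres about the origin is complete. -/
theorem exists_global_integral_curve {E : Type*} [NormedAddCommGroup E] [InnerProductSpace ℝ E]
    [FiniteDimensional ℝ E] {v : E → E} (hv : ContDiff ℝ 1 v) (hv0 : ∀ x, inner ℝ x (v x) = 0)
    (x₀ : E) : ∃ f : ℝ → E, f 0 = x₀ ∧ ∀ t, HasDerivAt f (v (f t)) t := by
  -- Cutting `v` off outside a ball around the sphere through `x₀` makes it bounded and globally
  -- Lipschitz. The cut-off field is still tangent to spheres, so its integral curve from `x₀` stays
  -- where `χ = 1`.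
  let χ : ContDiffBump (0 : E) := ⟨‖x₀‖ + 1, ‖x₀‖ + 2, by positivity, by linarith⟩
  have hχ : ∀ x, ‖x‖ = ‖x₀‖ → χ x = 1 := fun x hx =>
    χ.one_of_mem_closedBall (by simp [χ, hx])
  set w : E → E := fun x => χ x • v x with hw
  have hwd : ContDiff ℝ 1 w := χ.contDiff.smul hv
  have hwc : HasCompactSupport w := χ.hasCompactSupport.smul_right
  have hw0 : ∀ x, inner ℝ x (w x) = 0 := fun x => by simp [hw, inner_smul_right, hv0]
  obtain ⟨K, hK⟩ := hwd.lipschitzWith_of_hasCompactSupport hwc one_ne_zero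
  obtain ⟨L, hL⟩ : ∃ L : NNReal, ∀ x, ‖w x‖ ≤ L := by
    obtain ⟨L, hL⟩ := hwd.continuous.bounded_above_of_compact_support hwc
    exact ⟨⟨L, (norm_nonneg _).trans (hL 0)⟩, hL⟩
  -- Half-length `n + 1` rather than `n` keeps `0` in the interior of the interval when `n = 0`.
  have key : ∀ n : ℕ, ∃ f : ℝ → E, f 0 = x₀ ∧
      ∀ t ∈ Icc (-(n + 1 : ℝ)) (n + 1), HasDerivWithinAt f (w (f t)) (Icc (-(n + 1 : ℝ)) (n + 1)) t := by
    intro n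
    have h0 : (0 : ℝ) ∈ Icc (-(n + 1 : ℝ)) (n + 1) := ⟨by linarith [n.cast_nonneg (α := ℝ)], by positivity⟩
    have hpl : IsPicardLindelof (fun _ : ℝ => w) (tmin := -(n + 1 : ℝ)) (tmax := n + 1) ⟨0, h0⟩ x₀
        (L * (n + 1)) 0 L K :=
      .of_time_independent (fun x _ => hL x) hK.lipschitzOnWith (by simp)
    exact hpl.exists_eq_forall_mem_Icc_hasDerivWithinAt₀
  choose f hf0 hf using key
  have hfd : ∀ n : ℕ, ∀ t ∈ Ioo (-(n + 1 : ℝ)) (n + 1), HasDerivAt (f n) (w (f n t)) t := fun n t ht =>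
    (hf n t (Ioo_subset_Icc_self ht)).hasDerivAt (Icc_mem_nhds ht.1 ht.2)
  have huniq : ∀ m n : ℕ, m ≤ n → EqOn (f m) (f n) (Ioo (-(m + 1 : ℝ)) (m + 1)) := by
    intro m n hmn
    have hmn' : (m : ℝ) ≤ n := by exact_mod_cast hmn
    refine ODE_solution_unique_of_mem_Ioo (v := fun _ => w) (s := fun _ => univ) (t₀ := 0) (K := K)
      (fun t _ => hK.lipschitzOnWith) ⟨by linarith [m.cast_nonneg (α := ℝ)], by positivity⟩
      (fun t ht => ⟨hfd m t ht, mem_univ _⟩)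
      (fun t ht => ⟨hfd n t ⟨by linarith [ht.1], by linarith [ht.2]⟩, mem_univ _⟩) ?_
    rw [hf0, hf0]
  have hmem : ∀ t : ℝ, t ∈ Ioo (-((⌈|t|⌉₊ : ℝ) + 1)) (⌈|t|⌉₊ + 1) := fun t => by
    have := Nat.le_ceil |t|
    constructor <;> linarith [neg_abs_le t, le_abs_self t]
  -- The global curve takes at time `t` the value of a solution whose interval contains `t` in its
  -- interior; by `huniq` the choice does not matter locally.
  refine ⟨fun t => f ⌈|t|⌉₊ t, by simp [hf0], fun t => ?_⟩
  have hn : ‖f ⌈|t|⌉₊ t‖ = ‖x₀‖ := by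
    rw [← hf0 ⌈|t|⌉₊]
    exact norm_eq_of_inner_velocity_eq_zero (convex_Icc _ _) (hf _) (fun _ _ => hw0 _)
      (Ioo_subset_Icc_self (hmem t)) ⟨by linarith [Nat.cast_nonneg (α := ℝ) ⌈|t|⌉₊], by positivity⟩
  have hd := hfd _ t (hmem t)
  simp only [hw, hχ _ hn, one_smul] at hd
  refine hd.congr_of_eventuallyEq ?_
  filter_upwards [Ioo_mem_nhds (hmem t).1 (hmem t).2] with s hs
  rcases le_total ⌈|s|⌉₊ ⌈|t|⌉₊ with h | h
  · exact huniq _ _ h (hmem s)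
  · exact (huniq _ _ h hs).symm

/-! ### Linear equations depending on a parameter -/

/-- Continuous partial derivatives give strict differentiability, with a derivative assembled from
`g` and `h`. This is the bootstrap step for joint smoothness in `(y, λ)`. -/
lemma contDiff_succ_of_partials {E : Type*} [NormedAddCommGroup E] [NormedSpace ℝ E]
    [NormedSpace ℂ E] [IsScalarTower ℝ ℂ E] {f g h : ℝ × ℂ → E} {m : ℕ}
    (hy : ∀ y l, HasDerivAt (fun s : ℝ => f (s, l)) (g (y, l)) y)
    (hl : ∀ y l, HasDerivAt (fun w : ℂ => f (y, w)) (h (y, l)) l)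
    (hg : ContDiff ℝ m g) (hh : ContDiff ℝ m h) : ContDiff ℝ (m + 1) f := by
  let A : E →L[ℝ] ℝ →L[ℝ] E := (ContinuousLinearMap.lsmul ℝ ℝ : ℝ →L[ℝ] E →L[ℝ] E).flip
  let B : E →L[ℝ] ℂ →L[ℝ] E := (ContinuousLinearMap.lsmul ℝ ℂ : ℂ →L[ℝ] E →L[ℝ] E).flip
  have hA : ContDiff ℝ m fun p => A (g p) := A.contDiff.comp hg
  have hB : ContDiff ℝ m fun p => B (h p) := B.contDiff.comp hh
  refine contDiff_succ_iff_hasFDerivAt.2 ⟨fun p => (A (g p)).comp (.fst ℝ ℝ ℂ) +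
    (B (h p)).comp (.snd ℝ ℝ ℂ), ?_, fun p => ?_⟩
  · exact (hA.clm_comp contDiff_const).add (hB.clm_comp contDiff_const)
  · have hs := hasStrictFDerivAt_uncurry_coprod (𝕜 := ℝ) (u := p) (f := fun y l => f (y, l))
      (f₁ := fun y l => A (g (y, l))) (f₂ := fun y l => B (h (y, l)))
      (.of_forall fun v => ?_) (.of_forall fun v => ?_) hA.continuous.continuousAt
      hB.continuous.continuousAt
    · refine hs.hasFDerivAt.congr_fderiv ?_
      ext v <;> simp [Function.HasUncurry.uncurry]
    · refine (hy v.1 v.2).hasFDerivAt.congr_fderiv ?_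
      ext; simp [A, Function.HasUncurry.uncurry]
    · refine ((hl v.1 v.2).hasFDerivAt.restrictScalars ℝ).congr_fderiv ?_
      ext w; simp [B, Function.HasUncurry.uncurry]

section LinearFlow

variable {A : Type*} [NormedRing A] [NormedAlgebra ℂ A]

/-- The coefficients of the power series in `λ` of the solution of `C' = λ N C`, `C 0 = 1`. -/
def linCoeff (N : ℝ → A) : ℕ → ℝ → A
  | 0, _ => 1
  | n + 1, y => ∫ s in (0 : ℝ)..y, N s * linCoeff N n s

section

variable {N : ℝ → A} (hN : Continuous N)

include hN

lemma continuous_linCoeff (n : ℕ) : Continuous (linCoeff N n) := by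
  induction n with
  | zero => exact continuous_const
  | succ n ih =>
    exact intervalIntegral.continuous_primitive (fun a b => (hN.mul ih).intervalIntegrable a b) 0

lemma hasDerivAt_linCoeff_succ [CompleteSpace A] (n : ℕ) (y : ℝ) :
    HasDerivAt (linCoeff N (n + 1)) (N y * linCoeff N n y) y :=
  (hN.mul (continuous_linCoeff hN n)).integral_hasStrictDerivAt 0 y |>.hasDerivAt

open Set MeasureTheory in
-- An `n`-fold iterated integral over a simplex contributes `|y|ⁿ / n!`. The factor `‖1‖` remains
-- because the unit is not assumed to have norm one.
lemma norm_linCoeff_le {K Y : ℝ} (hK : ∀ s, |s| ≤ Y → ‖N s‖ ≤ K) (n : ℕ) {y : ℝ} (hy : |y| ≤ Y) :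
    ‖linCoeff N n y‖ ≤ ‖(1 : A)‖ * ((K * |y|) ^ n / n.factorial) := by
  have hK0 : 0 ≤ K := (norm_nonneg _).trans (hK y hy)
  induction n generalizing y with
  | zero => simp [linCoeff]
  | succ n ih =>
    have hs : ∀ s ∈ uIoc 0 y, |s| ≤ Y := by
      intro s hs
      rcases le_total 0 y with h | h
      · rw [uIoc_of_le h] at hs
        rw [abs_of_nonneg h] at hy
        rw [abs_of_pos hs.1]; linarith [hs.2]
      · rw [uIoc_of_ge h] at hs
        rw [abs_of_nonpos h] at hy
        rw [abs_of_nonpos hs.2]; linarith [hs.1]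
    calc ‖linCoeff N (n + 1) y‖ ≤ ∫ s in uIoc 0 y, ‖N s * linCoeff N n s‖ :=
          intervalIntegral.norm_integral_le_integral_norm_uIoc
      _ ≤ ∫ s in uIoc 0 y, (‖(1 : A)‖ * K ^ (n + 1) / n.factorial) * |s - 0| ^ n := by
          refine setIntegral_mono_on ?_ ?_ measurableSet_uIoc fun s hsy => ?_
          · exact ((hN.mul (continuous_linCoeff hN n)).norm.intervalIntegrable 0 y).def'
          · exact ((by fun_prop : Continuous fun s : ℝ =>
              (‖(1 : A)‖ * K ^ (n + 1) / n.factorial) * |s - 0| ^ n).intervalIntegrable 0 y).def'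
          · calc ‖N s * linCoeff N n s‖ ≤ K * (‖(1 : A)‖ * ((K * |s|) ^ n / n.factorial)) :=
                (norm_mul_le _ _).trans (mul_le_mul (hK s (hs s hsy)) (ih (hs s hsy))
                  (norm_nonneg _) hK0)
              _ = _ := by rw [sub_zero, mul_pow]; ring
      _ = _ := by
          rw [integral_const_mul, integral_pow_abs_sub_uIoc, sub_zero, Nat.factorial_succ]
          push_cast
          have h1 : (n.factorial : ℝ) ≠ 0 := by positivity
          have h2 : (n : ℝ) + 1 ≠ 0 := by positivity
          rw [mul_pow]
          field_simp

end

/-- The `n`-th term of the `k`-th derivative in `λ` of the power series. -/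
def linTerm (N : ℝ → A) (k n : ℕ) (p : ℝ × ℂ) : A :=
  (((n + k).factorial / n.factorial : ℂ) * p.2 ^ n) • linCoeff N (n + k) p.1

def linSum (N : ℝ → A) (k : ℕ) (p : ℝ × ℂ) : A := ∑' n, linTerm N k n p

section

variable {N : ℝ → A} (hN : Continuous N)

include hN

/-- The factor `(n + k)!` produced by `k` differentiations cancels the one in `norm_linCoeff_le`.
What remains is an exponential series, locally uniform in `(y, λ)`, with one `K` for all `k` and
`n`; it justifies every termwise operation below. -/
lemma exists_norm_linTerm_le (Y R : ℝ) : ∃ K : ℝ, 0 ≤ K ∧ ∀ k n (p : ℝ × ℂ), |p.1| ≤ Y → ‖p.2‖ ≤ R →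
    ‖linTerm N k n p‖ ≤ ‖(1 : A)‖ * K ^ k * ((R * K) ^ n / n.factorial) := by
  obtain ⟨K, hK⟩ := (isCompact_Icc (a := -Y) (b := Y)).exists_bound_of_continuousOn hN.continuousOn
  refine ⟨|K| * |Y|, by positivity, fun k n p hy hr => ?_⟩
  have hR : 0 ≤ R := (norm_nonneg _).trans hr
  have h1 := norm_linCoeff_le hN (K := |K|) (Y := Y)
    (fun s hs => (hK s (abs_le.1 hs)).trans (le_abs_self _)) (n + k) hy
  have h2 : (|K| * |p.1|) ^ (n + k) ≤ (|K| * |Y|) ^ (n + k) := by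
    exact pow_le_pow_left₀ (by positivity) (by exact mul_le_mul_of_nonneg_left (hy.trans (le_abs_self _)) (abs_nonneg _)) _
  rw [linTerm, norm_smul, norm_mul, norm_div, norm_pow, Complex.norm_natCast, Complex.norm_natCast]
  calc ((n + k).factorial / n.factorial * ‖p.2‖ ^ n) * ‖linCoeff N (n + k) p.1‖
      ≤ ((n + k).factorial / n.factorial * R ^ n) *
        (‖(1 : A)‖ * ((|K| * |Y|) ^ (n + k) / (n + k).factorial)) := by
        gcongr
        exact h1.trans (by gcongr)
    _ = _ := by
        have h1 : (n.factorial : ℝ) ≠ 0 := by positivity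
        have h2 : ((n + k).factorial : ℝ) ≠ 0 := by positivity
        field_simp
        ring

lemma summable_linTerm [CompleteSpace A] (k : ℕ) (p : ℝ × ℂ) : Summable fun n => linTerm N k n p := by
  obtain ⟨K, -, hK⟩ := exists_norm_linTerm_le hN |p.1| ‖p.2‖
  exact .of_norm_bounded ((Real.summable_pow_div_factorial _).mul_left _)
    fun n => hK k n p le_rfl le_rfl

lemma continuous_linSum [CompleteSpace A] (k : ℕ) : Continuous (linSum N k) := by
  rw [continuous_iff_continuousAt]
  intro p
  obtain ⟨K, -, hK⟩ := exists_norm_linTerm_le hN (|p.1| + 1) (‖p.2‖ + 1)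
  have hc : ContinuousOn (linSum N k) {q | |q.1| ≤ |p.1| + 1 ∧ ‖q.2‖ ≤ ‖p.2‖ + 1} := by
    refine continuousOn_tsum (fun n => ?_)
      ((Real.summable_pow_div_factorial _).mul_left (‖(1 : A)‖ * K ^ k))
      (fun n q hq => hK k n q hq.1 hq.2)
    have := continuous_linCoeff hN (n + k)
    unfold linTerm
    fun_prop
  refine hc.continuousAt ?_
  have h : IsOpen {q : ℝ × ℂ | |q.1| < |p.1| + 1 ∧ ‖q.2‖ < ‖p.2‖ + 1} :=
    (isOpen_lt (f := fun q : ℝ × ℂ => |q.1|) (by fun_prop) continuous_const).inter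
      (isOpen_lt (f := fun q : ℝ × ℂ => ‖q.2‖) (by fun_prop) continuous_const)
  exact Filter.mem_of_superset (h.mem_nhds ⟨by simp, by simp⟩) fun q hq => ⟨hq.1.le, hq.2.le⟩

lemma hasDerivAt_linSum_snd [CompleteSpace A] (k : ℕ) (y : ℝ) (l : ℂ) :
    HasDerivAt (fun w => linSum N k (y, w)) (linSum N (k + 1) (y, l)) l := by
  obtain ⟨K, hK0, hK⟩ := exists_norm_linTerm_le hN |y| (‖l‖ + 1)
  -- Differentiation kills the constant term and moves the others down by one place.
  let g' : ℕ → ℂ → A := fun n w => match n with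
    | 0 => 0
    | n + 1 => linTerm N (k + 1) n (y, w)
  have hd : ∀ n w, HasDerivAt (fun w => linTerm N k n (y, w)) (g' n w) w := by
    intro n w
    unfold linTerm
    cases n with
    | zero => simpa [g'] using hasDerivAt_const w _
    | succ n =>
      refine (((hasDerivAt_pow (n + 1) w).const_mul
        ((n + 1 + k).factorial / (n + 1).factorial : ℂ)).smul_const
        (linCoeff N (n + 1 + k) y)).congr_deriv ?_
      simp only [g', linTerm]
      rw [show n + 1 + k = n + (k + 1) by ring, Nat.factorial_succ n]
      congr 1
      have h1 : (n.factorial : ℂ) ≠ 0 := by exact_mod_cast n.factorial_ne_zero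
      have h2 : (n : ℂ) + 1 ≠ 0 := by exact_mod_cast n.succ_ne_zero
      push_cast
      field_simp
  let v : ℕ → ℝ := fun n => match n with
    | 0 => 0
    | n + 1 => ‖(1 : A)‖ * K ^ (k + 1) * (((‖l‖ + 1) * K) ^ n / n.factorial)
  have hv : Summable v :=
    (summable_nat_add_iff 1).1 ((Real.summable_pow_div_factorial ((‖l‖ + 1) * K)).mul_left
      (‖(1 : A)‖ * K ^ (k + 1)))
  have hb : ∀ n w, w ∈ Metric.ball (0 : ℂ) (‖l‖ + 1) → ‖g' n w‖ ≤ v n := by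
    intro n w hw
    cases n with
    | zero => simp [g', v]
    | succ n => exact hK _ n (y, w) le_rfl (by simpa using (mem_ball_zero_iff.1 hw).le)
  have hl : l ∈ Metric.ball (0 : ℂ) (‖l‖ + 1) := by simp
  have := hasDerivAt_tsum_of_isPreconnected hv Metric.isOpen_ball
    (convex_ball (0 : ℂ) (‖l‖ + 1)).isPreconnected (fun n w _ => hd n w) hb hl
    (summable_linTerm hN k (y, l)) hl
  refine this.congr_deriv ?_
  have hs : Summable fun n => g' n l := .of_norm_bounded hv fun n => hb n l hl
  rw [hs.tsum_eq_zero_add]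
  simp [g', linSum]

/-- This is `S' = λNS` differentiated `k` times in `λ`; Leibniz' rule produces the term with `k -
1`. For `k = 0` the truncated subtraction is harmless, as the coefficient `k` vanishes. -/
lemma hasDerivAt_linSum_fst [CompleteSpace A] (k : ℕ) (y : ℝ) (l : ℂ) :
    HasDerivAt (fun s => linSum N k (s, l))
      (N y * (l • linSum N k (y, l) + (k : ℂ) • linSum N (k - 1) (y, l))) y := by
  obtain ⟨K, hK0, hK⟩ := exists_norm_linTerm_le hN (|y| + 1) ‖l‖
  obtain ⟨K', hK'⟩ := (isCompact_Icc (a := -(|y| + 1)) (b := |y| + 1)).exists_bound_of_continuousOn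
    hN.continuousOn
  let t' : ℕ → ℝ → A := fun n s => match n with
    | 0 => 0
    | n + 1 => linTerm N k n (s, l)
  let g' : ℕ → ℝ → A := fun n s => N s * (l • t' n s + (k : ℂ) • linTerm N (k - 1) n (s, l))
  have hd : ∀ n s, HasDerivAt (fun s => linTerm N k n (s, l)) (g' n s) s := by
    intro n s
    unfold linTerm
    rcases Nat.eq_zero_or_pos (n + k) with h | h
    · obtain ⟨rfl, rfl⟩ : n = 0 ∧ k = 0 := by omega
      simpa [g', t', linCoeff] using! hasDerivAt_const s (1 : A)
    · obtain ⟨m, hm⟩ : ∃ m, n + k = m + 1 := ⟨n + k - 1, by omega⟩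
      rw [hm]
      refine ((hasDerivAt_linCoeff_succ hN m s).const_smul
        (((m + 1).factorial / n.factorial : ℂ) * l ^ n)).congr_deriv ?_
      simp only [g']
      rw [← mul_smul_comm]
      congr 1
      have h1 : (n.factorial : ℂ) ≠ 0 := by exact_mod_cast n.factorial_ne_zero
      cases n with
      | zero =>
        obtain rfl : k = m + 1 := by omega
        simp [t', linTerm, smul_smul, Nat.factorial_succ]
      | succ n =>
        obtain rfl : m = n + k := by omega
        have h1 : (n.factorial : ℂ) ≠ 0 := by exact_mod_cast n.factorial_ne_zero
        have h2 : (n : ℂ) + 1 ≠ 0 := by exact_mod_cast n.succ_ne_zero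
        cases k with
        | zero =>
          simp only [t', linTerm, smul_smul, Nat.cast_zero, zero_smul, add_zero, zero_mul]
          rw [div_self (by exact_mod_cast (n+1).factorial_ne_zero), div_self h1, pow_succ]
          congr 1; ring
        | succ k =>
          simp only [t', linTerm, smul_smul, Nat.add_sub_cancel]
          rw [show n + 1 + k = n + (k + 1) by ring, ← add_smul, Nat.factorial_succ n,
            Nat.factorial_succ (n + (k + 1))]
          congr 1
          push_cast
          field_simp
          ring
  let v : ℕ → ℝ := fun n => match n with
    | 0 => 0
    | n + 1 => ‖(1 : A)‖ * K ^ k * ((‖l‖ * K) ^ n / n.factorial)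
  have hv : Summable v :=
    (summable_nat_add_iff 1).1 ((Real.summable_pow_div_factorial (‖l‖ * K)).mul_left
      (‖(1 : A)‖ * K ^ k))
  have hball : ∀ s ∈ Metric.ball (0 : ℝ) (|y| + 1), |s| ≤ |y| + 1 := fun s hs => by
    simpa using (mem_ball_zero_iff.1 hs).le
  have ht' : ∀ n s, s ∈ Metric.ball (0 : ℝ) (|y| + 1) → ‖t' n s‖ ≤ v n := by
    intro n s hs
    cases n with
    | zero => simp [t', v]
    | succ n => exact hK _ n (s, l) (hball s hs) le_rfl
  have hb : ∀ n s, s ∈ Metric.ball (0 : ℝ) (|y| + 1) → ‖g' n s‖ ≤ |K'| * (‖l‖ * v n +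
      k * (‖(1 : A)‖ * K ^ (k - 1) * ((‖l‖ * K) ^ n / n.factorial))) := by
    intro n s hs
    refine (norm_mul_le _ _).trans (mul_le_mul
      ((hK' s (abs_le.1 (hball s hs))).trans (le_abs_self _)) ?_ (norm_nonneg _) (abs_nonneg _))
    refine (norm_add_le _ _).trans (add_le_add ?_ ?_)
    · rw [norm_smul]; gcongr; exact ht' n s hs
    · rw [norm_smul, Complex.norm_natCast]; gcongr; exact hK _ n (s, l) (hball s hs) le_rfl
  have hsum := ((hv.mul_left ‖l‖).add (((Real.summable_pow_div_factorial (‖l‖ * K)).mul_left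
      (‖(1 : A)‖ * K ^ (k - 1))).mul_left (k : ℝ))).mul_left |K'|
  have hy : y ∈ Metric.ball (0 : ℝ) (|y| + 1) := by simp
  have := hasDerivAt_tsum_of_isPreconnected hsum Metric.isOpen_ball
    (convex_ball (0 : ℝ) (|y| + 1)).isPreconnected (fun n s _ => hd n s) hb hy
    (summable_linTerm hN k (y, l)) hy
  refine this.congr_deriv ?_
  have hs1 : HasSum (fun n => t' n y) (linSum N k (y, l)) := by
    have hs : Summable fun n => t' n y := .of_norm_bounded hv fun n => ht' n y hy
    have h := hs.hasSum
    rw [hs.tsum_eq_zero_add] at h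
    simpa [t', linSum] using h
  exact (((hs1.const_smul l).add ((summable_linTerm hN (k - 1) (y, l)).hasSum.const_smul
    (k : ℂ))).mul_left (N y)).tsum_eq

end

/-- The solution of `∂C/∂y = λ N C`, `C (0, λ) = 1`, is smooth in `(y, λ)` and entire in `λ`. -/
theorem exists_smooth_linear_flow [CompleteSpace A] {N : ℝ → A} (hN : ContDiff ℝ ∞ N) : ∃ C : ℝ × ℂ → A,
    ContDiff ℝ ∞ C ∧ (∀ y l, HasDerivAt (fun s : ℝ => C (s, l)) (l • (N y * C (y, l))) y) ∧
    (∀ l, C (0, l) = 1) ∧ (∀ y, C (y, 0) = 1) ∧ ∀ y, Differentiable ℂ fun l => C (y, l) := by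
  have hc := hN.continuous
  refine ⟨linSum N 0, ?_, fun y l => ?_, fun l => ?_, fun y => ?_, fun y l =>
    (hasDerivAt_linSum_snd hc 0 y l).differentiableAt⟩
  · rw [contDiff_infty]
    -- The partial derivatives of the `k`-th sum involve only the sums with index `k - 1`, `k`, `k +
    -- 1`. Hence the induction on `m` must run over all `k` at once.
    have h : ∀ m : ℕ, ∀ k, ContDiff ℝ m (linSum N k) := by
      intro m
      induction m with
      | zero => exact fun k => contDiff_zero.2 (continuous_linSum hc k)
      | succ m ih =>
        intro k
        have hN' : ContDiff ℝ m N := hN.of_le (by exact_mod_cast le_top)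
        refine contDiff_succ_of_partials (fun y l => hasDerivAt_linSum_fst hc k y l)
          (fun y l => hasDerivAt_linSum_snd hc k y l)
          (g := fun p => N p.1 * (p.2 • linSum N k p + (k : ℂ) • linSum N (k - 1) p)) ?_ (ih _)
        let B : ℂ →L[ℝ] A →L[ℝ] A := ContinuousLinearMap.lsmul ℝ ℂ
        exact (hN'.comp contDiff_fst).mul
          ((B.isBoundedBilinearMap.contDiff.comp (contDiff_snd.prodMk (ih k))).add
            ((B k).contDiff.comp (ih _)))
    exact fun m => h m 0
  · simpa using hasDerivAt_linSum_fst hc 0 y l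
  · rw [linSum, tsum_eq_single 0]
    · simp [linTerm, linCoeff]
    · intro n hn
      obtain ⟨m, rfl⟩ := Nat.exists_eq_succ_of_ne_zero hn
      simp [linTerm, linCoeff]
  · rw [linSum, tsum_eq_single 0]
    · simp [linTerm, linCoeff]
    · intro n hn
      simp [linTerm, hn]

end LinearFlow

/-! ### Entrywise calculus of matrix valued maps -/

/-- Smoothness of a matrix valued map. -/
def MSmooth {E : Type*} [NormedAddCommGroup E] [NormedSpace ℝ E] (f : E → M2) : Prop :=
  ∀ i j, ContDiff ℝ ∞ fun x => f x i j

/-- The derivative of a curve of matrices. -/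
def MDeriv (f : ℝ → M2) (f' : M2) (t : ℝ) : Prop :=
  ∀ i j, HasDerivAt (fun s => f s i j) (f' i j) t

section MSmooth

variable {E : Type*} [NormedAddCommGroup E] [NormedSpace ℝ E] {f g : E → M2}

lemma msmooth_const (X : M2) : MSmooth fun _ : E => X := fun _ _ => contDiff_const

lemma MSmooth.mul (hf : MSmooth f) (hg : MSmooth g) : MSmooth fun x => f x * g x := by
  intro i j
  simp only [Matrix.mul_apply, Fin.sum_univ_two]
  exact ((hf i 0).mul (hg 0 j)).add ((hf i 1).mul (hg 1 j))

lemma MSmooth.add (hf : MSmooth f) (hg : MSmooth g) : MSmooth fun x => f x + g x :=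
  fun i j => (hf i j).add (hg i j)

lemma MSmooth.smul {c : E → ℂ} (hc : ContDiff ℝ ∞ c) (hf : MSmooth f) :
    MSmooth fun x => c x • f x :=
  fun i j => hc.mul (hf i j)

lemma MSmooth.comp {G : Type*} [NormedAddCommGroup G] [NormedSpace ℝ G] (hf : MSmooth f)
    {φ : G → E} (hφ : ContDiff ℝ ∞ φ) : MSmooth fun x => f (φ x) :=
  fun i j => (hf i j).comp hφ

lemma MSmooth.adjugate (hf : MSmooth f) : MSmooth fun x => (f x).adjugate := by
  intro i j
  simp only [Matrix.adjugate_fin_two]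
  fin_cases i <;> fin_cases j
  · simpa using hf 1 1
  · simpa using (hf 0 1).neg
  · simpa using (hf 1 0).neg
  · simpa using hf 0 0

end MSmooth

section MDeriv

variable {f g : ℝ → M2} {f' g' : M2} {t : ℝ}

lemma MDeriv.congr_deriv (hf : MDeriv f f' t) (h : f' = g') : MDeriv f g' t := h ▸ hf

lemma MDeriv.congr (hf : MDeriv f f' t) (h : ∀ s, g s = f s) : MDeriv g f' t :=
  funext h ▸ hf

lemma MDeriv.unique (hf : MDeriv f f' t) (hg : MDeriv f g' t) : f' = g' := by
  ext i j; exact (hf i j).unique (hg i j)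

lemma mderiv_const (X : M2) : MDeriv (fun _ => X) 0 t := fun _ _ => hasDerivAt_const _ _

lemma MDeriv.mul (hf : MDeriv f f' t) (hg : MDeriv g g' t) :
    MDeriv (fun s => f s * g s) (f' * g t + f t * g') t := by
  intro i j
  simp only [Matrix.mul_apply, Matrix.add_apply, Fin.sum_univ_two]
  exact (((hf i 0).mul (hg 0 j)).add ((hf i 1).mul (hg 1 j))).congr_deriv (by ring)

lemma MDeriv.mul_const (hf : MDeriv f f' t) (X : M2) : MDeriv (fun s => f s * X) (f' * X) t :=
  (hf.mul (mderiv_const X)).congr_deriv (by simp)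

lemma MDeriv.const_mul (X : M2) (hf : MDeriv f f' t) : MDeriv (fun s => X * f s) (X * f') t :=
  ((mderiv_const X).mul hf).congr_deriv (by simp)

lemma MDeriv.add (hf : MDeriv f f' t) (hg : MDeriv g g' t) :
    MDeriv (fun s => f s + g s) (f' + g') t :=
  fun i j => (hf i j).add (hg i j)

lemma MDeriv.sub (hf : MDeriv f f' t) (hg : MDeriv g g' t) :
    MDeriv (fun s => f s - g s) (f' - g') t :=
  fun i j => (hf i j).sub (hg i j)

lemma MDeriv.smul {c : ℝ → ℂ} {c' : ℂ} (hc : HasDerivAt c c' t) (hf : MDeriv f f' t) :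
    MDeriv (fun s => c s • f s) (c' • f t + c t • f') t :=
  fun i j => hc.mul (hf i j)

lemma MDeriv.const_smul (c : ℂ) (hf : MDeriv f f' t) : MDeriv (fun s => c • f s) (c • f') t :=
  ((MDeriv.smul (hasDerivAt_const t c) hf)).congr_deriv (by simp)

lemma MDeriv.conjTranspose (hf : MDeriv f f' t) :
    MDeriv (fun s => (f s).conjTranspose) f'.conjTranspose t :=
  fun i j => (hf j i).star

lemma MDeriv.comp_add_const {s : ℝ} (hf : MDeriv f f' (t + s)) : MDeriv (fun r => f (r + s)) f' t :=
  fun i j => (hf i j).comp_add_const t s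

lemma eq_of_mderiv_eq_zero (h : ∀ t, MDeriv f 0 t) (a b : ℝ) : f a = f b := by
  ext i j
  exact is_const_of_deriv_eq_zero (fun t => (h t i j).differentiableAt) (fun t => (h t i j).deriv) a b

end MDeriv

/-! ### The matrix exponential and linear flows of matrices -/

section Exp

attribute [local instance] Matrix.linftyOpNormedRing

/-- The `ℓ^∞` operator norm makes complex matrices a Banach algebra. -/
abbrev normedAlgebraM2 : NormedAlgebra ℂ M2 := Matrix.linftyOpNormedAlgebra

attribute [local instance] normedAlgebraM2

lemma msmooth_iff {E : Type*} [NormedAddCommGroup E] [NormedSpace ℝ E] {f : E → M2} :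
    MSmooth f ↔ ContDiff ℝ ∞ f := by
  let e : (Fin 2 → Fin 2 → ℂ) →L[ℂ] M2 :=
    LinearMap.toContinuousLinearMap (Matrix.ofLinearEquiv ℂ).toLinearMap
  let c : ∀ i j : Fin 2, M2 →L[ℂ] ℂ := fun i j =>
    LinearMap.toContinuousLinearMap (Matrix.entryLinearMap ℂ ℂ i j)
  refine ⟨fun hf => ?_, fun hf i j => ((c i j).restrictScalars ℝ).contDiff.comp hf⟩
  exact (e.restrictScalars ℝ).contDiff.comp (contDiff_pi.2 fun i => contDiff_pi.2 fun j => hf i j)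

lemma contDiff_exp_matrix : ContDiff ℝ ∞ (NormedSpace.exp : M2 → M2) :=
  contDiff_iff_contDiffAt.2 fun x =>
    (NormedSpace.exp_analytic (𝕂 := ℂ) x).restrictScalars.contDiffAt

lemma MSmooth.exp {E : Type*} [NormedAddCommGroup E] [NormedSpace ℝ E] {f : E → M2}
    (hf : MSmooth f) : MSmooth fun x => NormedSpace.exp (f x) :=
  msmooth_iff.2 (contDiff_exp_matrix.comp (msmooth_iff.1 hf))

lemma mderiv_iff {f : ℝ → M2} {f' : M2} {t : ℝ} : MDeriv f f' t ↔ HasDerivAt f f' t := by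
  refine ⟨fun h => hasDerivAt_pi.2 fun i => hasDerivAt_pi.2 fun j => h i j,
    fun h i j => hasDerivAt_pi.1 (hasDerivAt_pi.1 h i) j⟩

/-- The exponential of a curve has a derivative that depends only on the first order jet. -/
lemma MDeriv.exp_congr {f g : ℝ → M2} {V W : M2} {t : ℝ} (hf : MDeriv f V t) (hg : MDeriv g V t)
    (h : f t = g t) (hW : MDeriv (fun s => NormedSpace.exp (f s)) W t) :
    MDeriv (fun s => NormedSpace.exp (g s)) W t := by
  rw [mderiv_iff] at hf hg
  have hd : HasFDerivAt (NormedSpace.exp : M2 → M2) (fderiv ℝ (NormedSpace.exp : M2 → M2) (f t)) (f t) :=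
    (contDiff_exp_matrix.differentiable (by simp)).differentiableAt.hasFDerivAt
  have h1 := hd.comp_hasDerivAt t hf
  rw [h] at hd
  have h2 := hd.comp_hasDerivAt t hg
  rw [← h] at h2
  exact (mderiv_iff.2 h2).congr_deriv ((mderiv_iff.2 h1).unique hW)

lemma mderiv_exp_smul (X : M2) (t : ℝ) :
    MDeriv (fun s : ℝ => NormedSpace.exp ((s : ℂ) • X)) (X * NormedSpace.exp ((t : ℂ) • X)) t := by
  have h := hasDerivAt_exp_smul_const' (𝕂 := ℂ) X (t : ℂ)
  have h2 : ∀ i j, HasDerivAt (fun u : ℂ => NormedSpace.exp (u • X) i j)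
      ((X * NormedSpace.exp ((t : ℂ) • X)) i j) (t : ℂ) :=
    fun i j => hasDerivAt_pi.1 (hasDerivAt_pi.1 h i) j
  exact fun i j => (h2 i j).comp_ofReal

/-- The solution of `∂C/∂y = λ N C`, `C (0, λ) = 1`. -/
lemma exists_smooth_linear_matrix_flow {N : ℝ → M2} (hN : MSmooth N) : ∃ C : ℝ × ℂ → M2,
    MSmooth C ∧ (∀ y l, MDeriv (fun s : ℝ => C (s, l)) (l • (N y * C (y, l))) y) ∧
    (∀ l, C (0, l) = 1) ∧ (∀ y, C (y, 0) = 1) ∧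
    ∀ y i j, Differentiable ℂ fun l => C (y, l) i j := by
  let c : ∀ i j : Fin 2, M2 →L[ℂ] ℂ := fun i j =>
    LinearMap.toContinuousLinearMap (Matrix.entryLinearMap ℂ ℂ i j)
  obtain ⟨C, hC, hd, h0, h0', hl⟩ := exists_smooth_linear_flow (msmooth_iff.1 hN)
  exact ⟨C, msmooth_iff.2 hC, fun y l => mderiv_iff.2 (hd y l), h0, h0',
    fun y i j => (c i j).differentiable.comp (hl y)⟩

end Exp

/-! ### The reduced Lax equation -/

/-- Bootstrap: if `f` is `Cⁿ`, then so is `f' = v ∘ f`, and `f` is `Cⁿ⁺¹`. -/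
lemma contDiff_infty_of_integral_curve {E : Type*} [NormedAddCommGroup E] [NormedSpace ℝ E]
    {v : E → E} (hv : ContDiff ℝ ∞ v) {f : ℝ → E} (hf : ∀ t, HasDerivAt f (v (f t)) t) :
    ContDiff ℝ ∞ f := by
  refine contDiff_infty.2 fun n => ?_
  induction n with
  | zero => exact contDiff_zero.2 (continuous_iff_continuousAt.2 fun t => (hf t).continuousAt)
  | succ n ih =>
    have h : ContDiff ℝ (n + 1) f := by
      refine contDiff_succ_iff_deriv.2 ⟨fun t => (hf t).differentiableAt, by simp, ?_⟩
      rw [funext fun t => (hf t).deriv]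
      exact (hv.of_le (by exact_mod_cast le_top)).comp ih
    exact_mod_cast h

/-- The equation `u'' = 2 (p² exp (-4u) - q² exp (4u))` has global solutions, and
`u'² + p² exp (-4u) + q² exp (4u)` is conserved. -/
theorem exists_sinh_gordon (p q c : ℝ) : ∃ u : ℝ → ℝ, ContDiff ℝ ∞ u ∧ u 0 = 0 ∧
    deriv u 0 = c ∧ ∀ y, HasDerivAt (deriv u)
      (2 * ((p * Real.exp (-2 * u y)) ^ 2 - (q * Real.exp (2 * u y)) ^ 2)) y ∧
      deriv u y ^ 2 + (p * Real.exp (-2 * u y)) ^ 2 + (q * Real.exp (2 * u y)) ^ 2 =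
        c ^ 2 + p ^ 2 + q ^ 2 := by
  -- With `x₀ = p exp (-2u)`, `x₁ = q exp (2u)`, `x₂ = u'` the equation becomes first order and
  -- quadratic, and the conserved quantity is the squared norm. The function `u` is recovered below
  -- by integrating `x₂`.
  let v : E3 → E3 := fun x => !₂[-2 * x 2 * x 0, 2 * x 2 * x 1, 2 * (x 0 ^ 2 - x 1 ^ 2)]
  have hv : ContDiff ℝ ∞ v := by
    rw [contDiff_euclidean]
    intro i
    fin_cases i <;> simp [v] <;> fun_prop
  have hv0 : ∀ x, inner ℝ x (v x) = 0 := fun x => by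
    simp [v, PiLp.inner_apply, Fin.sum_univ_three]; ring
  obtain ⟨f, hf0, hf⟩ := exists_global_integral_curve (hv.of_le (by exact_mod_cast le_top)) hv0
    !₂[p, q, c]
  have hfs := contDiff_infty_of_integral_curve hv hf
  have hn : ∀ t, f t 2 ^ 2 + f t 0 ^ 2 + f t 1 ^ 2 = c ^ 2 + p ^ 2 + q ^ 2 := fun t => by
    have h := norm_eq_of_inner_velocity_eq_zero (s := Set.univ) convex_univ
      (fun t _ => (hf t).hasDerivWithinAt) (fun t _ => hv0 _) (Set.mem_univ t) (Set.mem_univ 0)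
    have h := congrArg (· ^ 2) h
    simp only [EuclideanSpace.norm_sq_eq, Fin.sum_univ_three, hf0, Real.norm_eq_abs, sq_abs] at h
    simp at h
    linarith
  have hd : ∀ i t, HasDerivAt (fun s => f s i) (v (f t) i) t := fun i t =>
    (EuclideanSpace.proj (𝕜 := ℝ) i).hasFDerivAt.comp_hasDerivAt t (hf t)
  have hc2 : ContDiff ℝ ∞ fun t => f t 2 := contDiff_euclidean.1 hfs 2
  set u : ℝ → ℝ := fun y => ∫ s in (0 : ℝ)..y, f s 2 with hu
  have hud : ∀ y, HasDerivAt u (f y 2) y := fun y =>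
    (hc2.continuous.integral_hasStrictDerivAt 0 y).hasDerivAt
  have hu' : deriv u = fun y => f y 2 := funext fun y => (hud y).deriv
  have hu0 : u 0 = 0 := by simp [hu]
  have h0 : ∀ y, f y 0 = p * Real.exp (-2 * u y) := fun y => by
    have h : ∀ t, HasDerivAt (fun s => f s 0 * Real.exp (2 * u s)) 0 t := fun t =>
      ((hd 0 t).mul ((hud t).const_mul 2).exp).congr_deriv (by simp [v]; ring)
    have := is_const_of_deriv_eq_zero (fun t => (h t).differentiableAt) (fun t => (h t).deriv) y 0
    simp only [hu0, hf0] at this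
    simp at this
    rw [← this, mul_assoc, ← Real.exp_add]; simp
  have h1 : ∀ y, f y 1 = q * Real.exp (2 * u y) := fun y => by
    have h : ∀ t, HasDerivAt (fun s => f s 1 * Real.exp (-2 * u s)) 0 t := fun t =>
      ((hd 1 t).mul ((hud t).const_mul (-2)).exp).congr_deriv (by simp [v]; ring)
    have := is_const_of_deriv_eq_zero (fun t => (h t).differentiableAt) (fun t => (h t).deriv) y 0
    simp only [hu0, hf0] at this
    simp at this
    rw [← this, mul_assoc, ← Real.exp_add]; simp
  refine ⟨u, ?_, hu0, by simp [hu', hf0], fun y => ⟨?_, ?_⟩⟩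
  · exact contDiff_infty_iff_deriv.2 ⟨fun y => (hud y).differentiableAt, hu' ▸ hc2⟩
  · rw [hu', ← h0, ← h1]
    simpa [v] using hd 2 y
  · rw [hu', ← h0, ← h1]
    exact hn y

/-- Off-diagonal matrices. -/
def offd (a b : ℂ) : M2 := !![0, a; b, 0]

/-- The diagonal part of `su(2)`. -/
def dg (c : ℝ) : M2 := !![Complex.I * c, 0; 0, -(Complex.I * c)]

/-- The polynomial Killing field `λ⁻¹ P + dg c - λ Pᴴ`, `P = offd a b`. -/
def kf (a b : ℂ) (c : ℝ) (l : ℂ) : M2 :=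
  l⁻¹ • offd a b + dg c - l • (offd a b).conjTranspose

/-- The data of a solution of the reduced Lax equation, a function `u` with
`u'' = 2 (|α|² - |β|²)`, where `α = exp (-2u) α₀` and `β = exp (2u) β₀`. -/
structure LaxData (a b : ℂ) (c : ℝ) where
  u : ℝ → ℝ
  α : ℝ → ℂ
  β : ℝ → ℂ
  γ : ℝ → ℝ
  smooth : ContDiff ℝ ∞ u
  zero : u 0 = 0 ∧ γ 0 = c
  α_eq : ∀ y, α y = a * Real.exp (-2 * u y)
  β_eq : ∀ y, β y = b * Real.exp (2 * u y)
  deriv_u : ∀ y, HasDerivAt u (γ y) y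
  deriv_γ : ∀ y, HasDerivAt (fun y => (γ y : ℂ))
    (2 * (α y * star (α y) - β y * star (β y))) y
  energy : ∀ y, γ y ^ 2 + ‖α y‖ ^ 2 + ‖β y‖ ^ 2 = c ^ 2 + ‖a‖ ^ 2 + ‖b‖ ^ 2

/-- The phases of `α` and `β` do not change with `y`, so only `‖a‖` and `‖b‖` enter and the real
equation suffices. -/
theorem nonempty_laxData (a b : ℂ) (c : ℝ) : Nonempty (LaxData a b c) := by
  obtain ⟨u, hu, h0, h1, h⟩ := exists_sinh_gordon ‖a‖ ‖b‖ c
  have hn : ∀ (a : ℂ) (r : ℝ), ‖a * Real.exp r‖ ^ 2 = (‖a‖ * Real.exp r) ^ 2 := fun a r => by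
    rw [norm_mul, Complex.norm_real, Real.norm_eq_abs, abs_of_pos (Real.exp_pos r)]
  refine ⟨⟨u, fun y => a * Real.exp (-2 * u y), fun y => b * Real.exp (2 * u y), deriv u, hu,
    ⟨h0, h1⟩, fun y => rfl, fun y => rfl, fun y =>
      (hu.differentiable (by simp) y).hasDerivAt, fun y => ?_, fun y => ?_⟩⟩
  · refine (h y).1.ofReal_comp.congr_deriv ?_
    simp only [RCLike.star_def, Complex.mul_conj']
    rw [← hn, ← hn]
    push_cast
    rfl
  · simp only [hn]
    exact (h y).2

section

variable {a b : ℂ} {c : ℝ} (d : LaxData a b c)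

include d

lemma LaxData.deriv_α (y : ℝ) : HasDerivAt d.α (-2 * d.γ y * d.α y) y := by
  rw [funext d.α_eq]
  exact (((d.deriv_u y).const_mul (-2)).exp.ofReal_comp.const_mul a).congr_deriv
    (by push_cast; ring)

lemma LaxData.deriv_β (y : ℝ) : HasDerivAt d.β (2 * d.γ y * d.β y) y := by
  rw [funext d.β_eq]
  exact (((d.deriv_u y).const_mul 2).exp.ofReal_comp.const_mul b).congr_deriv
    (by push_cast; ring)

lemma LaxData.smooth_γ : ContDiff ℝ ∞ d.γ := by
  rw [← funext fun y => (d.deriv_u y).deriv]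
  exact (contDiff_infty_iff_deriv.1 d.smooth).2

lemma LaxData.smooth_α : ContDiff ℝ ∞ d.α := by
  rw [funext d.α_eq]
  exact contDiff_const.mul (Complex.ofRealCLM.contDiff.comp (contDiff_const.mul d.smooth).exp)

lemma LaxData.smooth_β : ContDiff ℝ ∞ d.β := by
  rw [funext d.β_eq]
  exact contDiff_const.mul (Complex.ofRealCLM.contDiff.comp (contDiff_const.mul d.smooth).exp)

/-- `λ⁻¹ η₋ + η₀ + λ η₊` -/
def LaxData.eta (y : ℝ) (l : ℂ) : M2 := kf (d.α y) (d.β y) (d.γ y) l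

/-- `i λ⁻¹ η₋ - i λ η₊` -/
def LaxData.theta (y : ℝ) (l : ℂ) : M2 := kf (Complex.I * d.α y) (Complex.I * d.β y) 0 l

/-- `i η₀ + 2 i λ η₊` -/
def LaxData.plus (y : ℝ) (l : ℂ) : M2 :=
  Complex.I • dg (d.γ y) - (2 * Complex.I * l) • (offd (d.α y) (d.β y)).conjTranspose

end

/-! ### The positive factor -/

lemma tau_eq (X : M2) : tau X = !![X 0 0, -X 0 1; -X 1 0, X 1 1] := by
  rw [tau, Matrix.eta_fin_two X]
  simp

lemma tau_mul (X Y : M2) : tau (X * Y) = tau X * tau Y := by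
  ext i j
  fin_cases i <;> fin_cases j <;> 
    simp [tau_eq, Matrix.mul_apply, Fin.sum_univ_two] <;> ring

lemma tau_tau (X : M2) : tau (tau X) = X := by
  ext i j
  fin_cases i <;> fin_cases j <;> simp [tau_eq]

lemma MDeriv.tau {f : ℝ → M2} {f' : M2} {t : ℝ} (hf : MDeriv f f' t) :
    MDeriv (fun s => tau (f s)) (tau f') t :=
  (hf.const_mul _).mul_const _

lemma MDeriv.det {f : ℝ → M2} {f' : M2} {t : ℝ} (hf : MDeriv f f' t) :
    HasDerivAt (fun s => (f s).det) ((f t).adjugate * f').trace t := by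
  simp only [Matrix.det_fin_two]
  refine (((hf 0 0).mul (hf 1 1)).sub ((hf 0 1).mul (hf 1 0))).congr_deriv ?_
  simp [Matrix.adjugate_fin_two, Matrix.trace_fin_two, Matrix.vecMul, dotProduct, Fin.sum_univ_two]
  ring

lemma MDeriv.adjugate {f : ℝ → M2} {f' : M2} {t : ℝ} (hf : MDeriv f f' t) :
    MDeriv (fun s => (f s).adjugate) f'.adjugate t := by
  intro i j
  simp only [Matrix.adjugate_fin_two]
  fin_cases i <;> fin_cases j
  · simpa using hf 1 1
  · simpa using (hf 0 1).fun_neg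
  · simpa using (hf 1 0).fun_neg
  · simpa using hf 0 0

lemma adjugate_eq_neg {M : M2} (h : M.trace = 0) : M.adjugate = -M := by
  rw [Matrix.trace_fin_two] at h
  rw [Matrix.adjugate_fin_two]
  ext i j
  fin_cases i <;> fin_cases j <;> simp <;> linear_combination h

lemma det_eq_of_mderiv_left {f M : ℝ → M2} (hf : ∀ t, MDeriv f (M t * f t) t)
    (hM : ∀ t, (M t).trace = 0) (s t : ℝ) : (f s).det = (f t).det := by
  have h : ∀ t, HasDerivAt (fun s => (f s).det) 0 t := fun t => (hf t).det.congr_deriv (by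
    rw [Matrix.trace_mul_comm, mul_assoc, Matrix.mul_adjugate]; simp [hM])
  exact is_const_of_deriv_eq_zero (fun t => (h t).differentiableAt) (fun t => (h t).deriv) s t

lemma det_eq_of_mderiv_right {f M : ℝ → M2} (hf : ∀ t, MDeriv f (f t * M t) t)
    (hM : ∀ t, (M t).trace = 0) (s t : ℝ) : (f s).det = (f t).det := by
  have h : ∀ t, HasDerivAt (fun s => (f s).det) 0 t := fun t => (hf t).det.congr_deriv (by
    rw [← mul_assoc, Matrix.adjugate_mul]; simp [hM])
  exact is_const_of_deriv_eq_zero (fun t => (h t).differentiableAt) (fun t => (h t).deriv) s t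

/-- The quotient `f⁻¹ g` is constant. The adjugate stands in for the inverse: it is linear in the
entries of a `2 × 2` matrix, and it is the inverse because traceless coefficients preserve the
determinant. -/
lemma eq_of_mderiv_left {f g M : ℝ → M2} (hf : ∀ t, MDeriv f (M t * f t) t)
    (hg : ∀ t, MDeriv g (M t * g t) t) (hM : ∀ t, (M t).trace = 0) (hf0 : f 0 = 1)
    (hg0 : g 0 = 1) (t : ℝ) : f t = g t := by
  have h : ∀ t, MDeriv (fun s => (f s).adjugate * g s) 0 t := fun t =>
    ((hf t).adjugate.mul (hg t)).congr_deriv (by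
      rw [Matrix.adjugate_mul_distrib, adjugate_eq_neg (hM t)]; noncomm_ring)
  have h1 := eq_of_mderiv_eq_zero h t 0
  simp only [hf0, hg0, Matrix.adjugate_one, mul_one] at h1
  have h2 : (f t).det = 1 := by rw [det_eq_of_mderiv_left hf hM t 0, hf0, Matrix.det_one]
  rw [← mul_one (f t), ← h1, ← mul_assoc, Matrix.mul_adjugate, h2, one_smul, one_mul]

lemma trace_kf (a b : ℂ) (c : ℝ) (l : ℂ) : (kf a b c l).trace = 0 := by
  simp [kf, offd, dg, Matrix.trace_fin_two]

lemma tau_kf (a b : ℂ) (c : ℝ) (l : ℂ) : tau (kf a b c l) = kf a b c (-l) := by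
  ext i j
  fin_cases i <;> fin_cases j <;> simp [tau_eq, kf, offd, dg, inv_neg] <;> ring

section

variable {a b : ℂ} {c : ℝ} (d : LaxData a b c)

include d

lemma LaxData.trace_plus (y : ℝ) (l : ℂ) : (d.plus y l).trace = 0 := by
  simp [LaxData.plus, offd, dg, Matrix.trace_fin_two]

lemma LaxData.tau_plus (y : ℝ) (l : ℂ) : tau (d.plus y l) = d.plus y (-l) := by
  ext i j
  fin_cases i <;> fin_cases j <;> simp [tau_eq, LaxData.plus, offd, dg]

lemma LaxData.plus_eq (y : ℝ) (l : ℂ) : d.plus y l = Complex.I • d.eta y l - d.theta y l := by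
  ext i j
  fin_cases i <;> fin_cases j <;>
    simp [LaxData.plus, LaxData.eta, LaxData.theta, kf, offd, dg] <;> ring

lemma LaxData.eta_zero (l : ℂ) : d.eta 0 l = kf a b c l := by
  simp [LaxData.eta, d.α_eq, d.β_eq, d.zero.1, d.zero.2]

/-- The Lax equation. -/
lemma LaxData.mderiv_eta {l : ℂ} (hl : l ≠ 0) (y : ℝ) : MDeriv (fun s => d.eta s l)
    (d.plus y l * d.eta y l - d.eta y l * d.plus y l) y := by
  have hα := d.deriv_α y
  have hβ := d.deriv_β y
  have hγ := d.deriv_γ y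
  have hα' := hα.star
  have hβ' := hβ.star
  intro i j
  fin_cases i <;> fin_cases j <;>
    simp [LaxData.plus, LaxData.eta, kf, offd, dg, Matrix.mul_apply, Fin.sum_univ_two]
  · refine (hγ.const_mul Complex.I).congr_deriv ?_
    simp
    field_simp
    ring
  · refine ((hα.const_mul l⁻¹).sub (hβ'.const_mul l)).congr_deriv ?_
    simp
    field_simp
    ring_nf
    simp
    ring
  · refine ((hβ.const_mul l⁻¹).sub (hα'.const_mul l)).congr_deriv ?_
    simp
    field_simp
    ring_nf
    simp
  · refine (hγ.const_mul Complex.I).neg.congr_deriv ?_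
    simp
    field_simp
    ring

/-- The positive Iwasawa factor of `exp (i y ξ)`. -/
structure LaxData.PlusFlow where
  B : ℝ × ℂ → M2
  smooth : MSmooth B
  deriv : ∀ y l, MDeriv (fun s => B (s, l)) (d.plus y l * B (y, l)) y
  zero : ∀ l, B (0, l) = 1
  center : ∀ y, B (y, 0) = !![(Real.exp (-d.u y) : ℂ), 0; 0, (Real.exp (-d.u y) : ℂ)⁻¹]
  entire : ∀ y i j, Differentiable ℂ fun l => B (y, l) i j

/-- Variation of constants. The matrix `D = diag (exp (-u), exp u)` solves `D' = iη₀ D`, and the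
ansatz `B = D C` leaves `C' = λ N C` with `N = 2i D⁻¹ η₊ D`. Since `C = 1` at `λ = 0`, the central
value `B(y, 0) = D` is diagonal and positive, as `Λ₊` requires. -/
theorem LaxData.nonempty_plusFlow : Nonempty d.PlusFlow := by
  have he : ∀ r : ℝ, ContDiff ℝ ∞ fun y => (Real.exp (r * d.u y) : ℂ) := fun r =>
    Complex.ofRealCLM.contDiff.comp (contDiff_const.mul d.smooth).exp
  let N : ℝ → M2 := fun y => !![0, -(2 * Complex.I) * star (d.β y) * Real.exp (2 * d.u y);
    -(2 * Complex.I) * star (d.α y) * Real.exp (-2 * d.u y), 0]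
  have hN : MSmooth N := by
    intro i j
    have h1 : ContDiff ℝ ∞ fun y => star (d.α y) := Complex.conjCLE.contDiff.comp d.smooth_α
    have h2 : ContDiff ℝ ∞ fun y => star (d.β y) := Complex.conjCLE.contDiff.comp d.smooth_β
    fin_cases i <;> fin_cases j
    · exact contDiff_const
    · exact (contDiff_const.mul h2).mul (he 2)
    · exact (contDiff_const.mul h1).mul (he (-2))
    · exact contDiff_const
  obtain ⟨C, hC, hd, h0, h0', hl⟩ := exists_smooth_linear_matrix_flow hN
  let D : ℝ → M2 := fun y => !![(Real.exp (-1 * d.u y) : ℂ), 0; 0, (Real.exp (1 * d.u y) : ℂ)]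
  have hD : MSmooth D := by
    intro i j
    fin_cases i <;> fin_cases j
    · exact he (-1)
    · exact contDiff_const
    · exact contDiff_const
    · exact he 1
  have hDd : ∀ y, MDeriv D (!![-(d.γ y : ℂ), 0; 0, (d.γ y : ℂ)] * D y) y := by
    intro y i j
    fin_cases i <;> fin_cases j
    · exact ((d.deriv_u y).const_mul (-1)).exp.ofReal_comp.congr_deriv
        (by simp [D, Matrix.mul_apply, Fin.sum_univ_two]; ring)
    · simpa [D, Matrix.mul_apply, Fin.sum_univ_two] using hasDerivAt_const y (0 : ℂ)
    · simpa [D, Matrix.mul_apply, Fin.sum_univ_two] using hasDerivAt_const y (0 : ℂ)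
    · exact ((d.deriv_u y).const_mul 1).exp.ofReal_comp.congr_deriv
        (by simp [D, Matrix.mul_apply, Fin.sum_univ_two]; ring)
  refine ⟨⟨fun p => D p.1 * C p, (hD.comp contDiff_fst).mul hC, fun y l => ?_, fun l => ?_,
    fun y => ?_, fun y i j => ?_⟩⟩
  · refine ((hDd y).mul (hd y l)).congr_deriv ?_
    have hk : !![-(d.γ y : ℂ), 0; 0, (d.γ y : ℂ)] * D y + l • (D y * N y) = d.plus y l * D y := by
      have h1 : (Real.exp (2 * d.u y) : ℂ) = Real.exp (1 * d.u y) * Real.exp (1 * d.u y) := by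
        rw [← Complex.ofReal_mul, ← Real.exp_add]; ring_nf
      have h2 : (Real.exp (-2 * d.u y) : ℂ) = Real.exp (-1 * d.u y) * Real.exp (-1 * d.u y) := by
        rw [← Complex.ofReal_mul, ← Real.exp_add]; ring_nf
      have h3 : (Real.exp (1 * d.u y) : ℂ) * Real.exp (-1 * d.u y) = 1 := by
        rw [← Complex.ofReal_mul, ← Real.exp_add]; simp
      simp only [N, D, h1, h2]
      ext i j
      fin_cases i <;> fin_cases j <;>
        simp only [LaxData.plus, offd, dg, Matrix.mul_apply, Fin.sum_univ_two, Matrix.add_apply,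
          Matrix.sub_apply, Matrix.smul_apply, Matrix.conjTranspose_apply] <;> simp
      · ring_nf; simp
      · simp at h3
        linear_combination (2 * l * Complex.I * (starRingEnd ℂ) (d.β y) *
          Complex.exp (d.u y)) * h3
      · simp at h3
        linear_combination (2 * l * Complex.I * (starRingEnd ℂ) (d.α y) *
          Complex.exp (-d.u y)) * h3
      · ring_nf; simp
    rw [← mul_assoc, ← hk, add_mul, mul_smul_comm, smul_mul_assoc, mul_assoc (D y)]
  · simp only [h0, mul_one, D, d.zero.1]
    ext i j
    fin_cases i <;> fin_cases j <;> simp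
  · simp only [h0', mul_one, D]
    ext i j
    fin_cases i <;> fin_cases j <;> simp [Complex.exp_neg]
  · simp only [Matrix.mul_apply, Fin.sum_univ_two]
    exact ((hl y 0 j).const_mul _).add ((hl y 1 j).const_mul _)

end

/-! ### The extended frame -/

lemma mderiv_line {G X : ℂ → M2} {v : ℂ}
    (h : ∀ z, MDeriv (fun t : ℝ => G (z + t * v)) (X z) 0) (z : ℂ) (t : ℝ) :
    MDeriv (fun s : ℝ => G (z + s * v)) (X (z + t * v)) t := by
  have h1 := h (z + t * v)
  rw [← sub_self t, sub_eq_add_neg] at h1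
  intro i j
  refine (((h1 i j).comp_add_const t (-t)).congr_of_eventuallyEq (.of_forall fun s => ?_))
  exact congrArg (fun w => G w i j) (by push_cast; ring)

lemma mderiv_exp_line (X : M2) (z v : ℂ) : MDeriv (fun t : ℝ => NormedSpace.exp ((z + t * v) • X))
    (NormedSpace.exp (z • X) * (v • X)) 0 := by
  have h := ((mderiv_exp_smul (v • X) 0).const_mul (NormedSpace.exp (z • X)))
  simp only [Complex.ofReal_zero, zero_smul, NormedSpace.exp_zero, mul_one] at h
  intro i j
  refine (h i j).congr_of_eventuallyEq (.of_forall fun s => ?_)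
  simp only
  rw [add_smul, Matrix.exp_add_of_commute, mul_smul]
  exact ((Commute.refl X).smul_left z).smul_right _

lemma dirDeriv_eq {G : ℂ → M2} (hG : MSmooth G) {z v : ℂ} {X : M2}
    (h : MDeriv (fun t : ℝ => G (z + t * v)) X 0) : dirDeriv G z v = X := by
  ext i j
  have h1 : HasFDerivAt (fun w => G w i j) (fderiv ℝ (fun w => G w i j) z) (z + (0 : ℝ) * v) := by
    simpa using ((hG i j).differentiable (by simp) z).hasFDerivAt
  have h2 : HasDerivAt (fun t : ℝ => z + t * v) v 0 := by
    simpa using ((hasDerivAt_id (0 : ℝ)).ofReal_comp.mul_const v).const_add z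
  have h3 : HasDerivAt ((fun w => G w i j) ∘ fun t : ℝ => z + t * v) (X i j) 0 := h i j
  exact (h1.comp_hasDerivAt (0 : ℝ) h2).unique h3

lemma star_circle (l : Circle) : (starRingEnd ℂ) (l : ℂ) = (l : ℂ)⁻¹ := by
  rw [← Circle.coe_inv, Circle.coe_inv_eq_conj]

lemma kf_conjTranspose (a b : ℂ) (c : ℝ) (l : Circle) :
    (kf a b c l).conjTranspose = -kf a b c l := by
  have h := star_circle l
  ext i j
  fin_cases i <;> fin_cases j <;> simp [kf, offd, dg, h]

lemma contDiff_circle_exp : ContDiff ℝ ∞ fun t : ℝ => (Circle.exp t : ℂ) := by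
  simp only [Circle.coe_exp]
  exact (Complex.ofRealCLM.contDiff.mul contDiff_const).cexp

lemma msmooth_kf_exp (a b : ℂ) (c : ℝ) : MSmooth fun t : ℝ => kf a b c (Circle.exp t) := by
  have h : MSmooth fun t : ℝ => (Circle.exp t : ℂ)⁻¹ • offd a b + dg c +
      (-(Circle.exp t : ℂ)) • (offd a b).conjTranspose :=
    ((MSmooth.smul (contDiff_circle_exp.inv fun t => Circle.coe_ne_zero _)
      (msmooth_const _)).add (msmooth_const _)).add
      (MSmooth.smul contDiff_circle_exp.neg (msmooth_const _))
  simpa [kf, sub_eq_add_neg] using h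

lemma exp_tau (X : M2) : NormedSpace.exp (tau X) = tau (NormedSpace.exp X) := by
  let S : M2ˣ := ⟨!![1, 0; 0, -1], !![1, 0; 0, -1],
    by ext i j; fin_cases i <;> fin_cases j <;> simp,
    by ext i j; fin_cases i <;> fin_cases j <;> simp⟩
  exact Matrix.exp_units_conj S X

section

variable {a b : ℂ} {c : ℝ} {d : LaxData a b c} (f : d.PlusFlow)

namespace LaxData.PlusFlow

include f in
lemma det_B (y : ℝ) (l : ℂ) : (f.B (y, l)).det = 1 := by
  rw [det_eq_of_mderiv_left (f := fun s => f.B (s, l)) (fun y => f.deriv y l)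
    (fun y => d.trace_plus y l) y 0, f.zero, Matrix.det_one]

lemma B_neg (y : ℝ) (l : ℂ) : f.B (y, -l) = tau (f.B (y, l)) := by
  refine eq_of_mderiv_left (f := fun s => f.B (s, -l)) (g := fun s => tau (f.B (s, l)))
    (fun y => f.deriv y (-l)) (fun y => (f.deriv y l).tau.congr_deriv ?_)
    (fun y => d.trace_plus y (-l)) (f.zero _) ?_ y
  · rw [tau_mul, d.tau_plus]
  · simp only [f.zero]
    ext i j
    fin_cases i <;> fin_cases j <;> simp [tau_eq]

/-- The value at `z` of the extended frame generated by the potential. -/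
def frame (z l : ℂ) : M2 := NormedSpace.exp (z • kf a b c l) * (f.B (z.im, l)).adjugate

lemma frame_mul_B (z l : ℂ) : f.frame z l * f.B (z.im, l) = NormedSpace.exp (z • kf a b c l) := by
  rw [frame, mul_assoc, Matrix.adjugate_mul, f.det_B, one_smul, mul_one]

lemma frame_zero (l : ℂ) : f.frame 0 l = 1 := by simp [frame, f.zero]

/-- By the Lax equation and the equation for `B`, the matrix `B⁻¹ η B` does not depend on `y`; at `y
= 0` it equals `ξ`. -/
lemma kf_mul_adjugate {l : ℂ} (hl : l ≠ 0) (y : ℝ) :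
    kf a b c l * (f.B (y, l)).adjugate = (f.B (y, l)).adjugate * d.eta y l := by
  have h : ∀ y, MDeriv (fun s => (f.B (s, l)).adjugate * d.eta s l * f.B (s, l)) 0 y := fun y =>
    (((f.deriv y l).adjugate.mul (d.mderiv_eta hl y)).mul (f.deriv y l)).congr_deriv (by
      rw [Matrix.adjugate_mul_distrib, adjugate_eq_neg (d.trace_plus y l)]
      noncomm_ring)
  have h1 := eq_of_mderiv_eq_zero h 0 y
  simp only [f.zero, Matrix.adjugate_one, one_mul, mul_one, d.eta_zero] at h1
  rw [h1, mul_assoc, Matrix.mul_adjugate, f.det_B, one_smul, mul_one]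

lemma kf_mul_frame {l : ℂ} (hl : l ≠ 0) (z : ℂ) :
    NormedSpace.exp (z • kf a b c l) * kf a b c l * (f.B (z.im, l)).adjugate =
      f.frame z l * d.eta z.im l := by
  rw [frame, mul_assoc, f.kf_mul_adjugate hl, mul_assoc]

lemma mderiv_frame_x {l : ℂ} (hl : l ≠ 0) (z : ℂ) :
    MDeriv (fun t : ℝ => f.frame (z + t * 1) l) (f.frame z l * d.eta z.im l) 0 := by
  refine (((mderiv_exp_line (kf a b c l) z 1).mul_const (f.B (z.im, l)).adjugate).congr_deriv
    ?_).congr fun s => ?_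
  · rw [one_smul, f.kf_mul_frame hl]
  · simp [frame]

/-- Here `F⁻¹ F_y = B (iξ) B⁻¹ - B' B⁻¹ = iη - (iη₀ + 2iλη₊) = θ`. The equation for `B` was chosen
to subtract exactly what prevents `iη` from lying in `su(2)` on the circle. -/
lemma mderiv_frame_y {l : ℂ} (hl : l ≠ 0) (z : ℂ) :
    MDeriv (fun t : ℝ => f.frame (z + t * Complex.I) l) (f.frame z l * d.theta z.im l) 0 := by
  have h1 : MDeriv (fun t : ℝ => f.B (t + z.im, l)) (d.plus z.im l * f.B (z.im, l)) 0 :=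
    MDeriv.comp_add_const (f := fun y => f.B (y, l)) (by simpa using f.deriv z.im l)
  refine (((mderiv_exp_line (kf a b c l) z Complex.I).mul h1.adjugate).congr_deriv ?_).congr
    fun s => ?_
  · have h2 := f.kf_mul_frame hl z
    have h3 : d.theta z.im l = Complex.I • d.eta z.im l - d.plus z.im l := by
      rw [d.plus_eq]; abel
    rw [h3, mul_sub, mul_smul_comm Complex.I (f.frame z l), ← h2,
      Matrix.adjugate_mul_distrib,
      adjugate_eq_neg (d.trace_plus _ l)]
    simp [frame]
    noncomm_ring
  · simp [frame, add_comm]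

lemma frame_msmooth : MSmooth fun q : ℂ × ℝ => f.frame q.1 (Circle.exp q.2) := by
  refine (MSmooth.exp (MSmooth.smul contDiff_fst ((msmooth_kf_exp a b c).comp contDiff_snd))).mul
    (MSmooth.adjugate (f.smooth.comp ?_))
  exact (Complex.imCLM.contDiff.comp contDiff_fst).prodMk (contDiff_circle_exp.comp contDiff_snd)

lemma det_frame {l : ℂ} (hl : l ≠ 0) (z : ℂ) : (f.frame z l).det = 1 := by
  -- The path from `0` to `z` runs up the imaginary axis (`h2`) and then horizontally (`h1`); the
  -- determinant is constant on each leg.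
  have h1 := det_eq_of_mderiv_right (mderiv_line (G := fun z => f.frame z l)
    (X := fun z => f.frame z l * d.eta z.im l) (f.mderiv_frame_x hl) (z.im * Complex.I))
    (fun t => trace_kf _ _ _ _) z.re 0
  have h2 := det_eq_of_mderiv_right (mderiv_line (G := fun z => f.frame z l)
    (X := fun z => f.frame z l * d.theta z.im l) (f.mderiv_frame_y hl) 0)
    (fun t => trace_kf _ _ _ _) z.im 0
  simp only [Complex.ofReal_zero, zero_mul, add_zero, mul_one, zero_add, f.frame_zero,
    Matrix.det_one] at h1 h2
  rw [← h2, ← h1, add_comm, Complex.re_add_im]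

/-- On the circle `η` and `θ` are skew-Hermitian, so `F Fᴴ` is constant along horizontal and
vertical lines. -/
lemma frame_mul_conjTranspose (z : ℂ) (l : Circle) :
    f.frame z l * (f.frame z l).conjTranspose = 1 := by
  have key : ∀ {v : ℂ} {X : ℂ → M2},
      (∀ z, MDeriv (fun t : ℝ => f.frame (z + t * v) l) (f.frame z l * X z) 0) →
      (∀ z, (X z).conjTranspose = -X z) → ∀ z (t : ℝ),
      f.frame (z + t * v) l * (f.frame (z + t * v) l).conjTranspose =
        f.frame (z + (0 : ℝ) * v) l * (f.frame (z + (0 : ℝ) * v) l).conjTranspose := by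
    intro v X h hX z t
    refine eq_of_mderiv_eq_zero (f := fun t : ℝ =>
      f.frame (z + t * v) l * (f.frame (z + t * v) l).conjTranspose) (fun t => ?_) t 0
    have := mderiv_line (G := fun z => f.frame z l) (X := fun z => f.frame z l * X z) h z t
    refine (this.mul this.conjTranspose).congr_deriv ?_
    rw [Matrix.conjTranspose_mul, hX]
    noncomm_ring
  have h1 := key (f.mderiv_frame_x (Circle.coe_ne_zero l)) (fun z => kf_conjTranspose _ _ _ l)
    (z.im * Complex.I) z.re
  have h2 := key (f.mderiv_frame_y (Circle.coe_ne_zero l)) (fun z => kf_conjTranspose _ _ _ l)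
    0 z.im
  simp only [Complex.ofReal_zero, zero_mul, add_zero, mul_one, zero_add, f.frame_zero,
    Matrix.conjTranspose_one] at h1 h2
  rw [← h2, ← h1, add_comm, Complex.re_add_im]

lemma frame_inLoop (z : ℂ) : InLoopSU2 fun l => f.frame z l where
  smooth := f.frame_msmooth.comp (contDiff_const.prodMk contDiff_id)
  mem l := Matrix.mem_specialUnitaryGroup_iff.2
    ⟨Matrix.mem_unitaryGroup_iff.2 (f.frame_mul_conjTranspose z l),
      f.det_frame (Circle.coe_ne_zero l) z⟩
  twisted l m h := by
    have h1 : tau (z • kf a b c l) = z • kf a b c m := by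
      rw [h, ← tau_kf, tau, tau, mul_smul_comm, smul_mul_assoc]
    have h2 : (f.B (z.im, m)).adjugate = tau (f.B (z.im, l)).adjugate := by
      rw [h, f.B_neg, tau_eq, tau_eq, Matrix.adjugate_fin_two, Matrix.adjugate_fin_two]
      simp
    simp only [frame]
    rw [tau_mul, ← exp_tau, h1, h2]

lemma B_inLoopPlus (y : ℝ) : InLoopPlus fun l => f.B (y, l) where
  smooth := f.smooth.comp (contDiff_const.prodMk contDiff_circle_exp)
  det_eq_one l := f.det_B y l
  twisted l m h := by simp only [h, f.B_neg]
  extends_holomorphically := ⟨fun w => f.B (y, w), fun i j => (f.entire y i j).diffContOnCl,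
    fun w _ => f.det_B y w, fun l => rfl, _, Real.exp_pos _, f.center y⟩

lemma frame_isExtendedFrame : IsExtendedFrame fun z (l : Circle) => f.frame z l where
  mem := f.frame_inLoop
  smooth := f.frame_msmooth
  form := by
    refine ⟨fun z => dg (d.γ z.im), fun _ => 0, fun z => offd (d.α z.im) (d.β z.im), fun z =>
      ⟨⟨⟨?_, ?_⟩, ?_⟩, ⟨⟨?_, ?_⟩, ?_⟩, ?_, fun l => ⟨?_, ?_⟩⟩⟩
    · ext i j; fin_cases i <;> fin_cases j <;> simp [dg]
    · simp [dg, Matrix.trace_fin_two]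
    · simp [tau_eq, dg]
    · simp
    · simp
    · simp [tau]
    · ext i j; fin_cases i <;> fin_cases j <;> simp [tau_eq, offd]
    all_goals
      have hs : MSmooth fun w : ℂ => f.frame w l := by
        obtain ⟨t, rfl⟩ := Circle.exp_surjective l
        exact f.frame_msmooth.comp (contDiff_id.prodMk contDiff_const)
      have hu : IsUnit (f.frame z l).det := by
        rw [f.det_frame (Circle.coe_ne_zero l)]; exact isUnit_one
    · rw [dirDeriv_eq hs (f.mderiv_frame_x (Circle.coe_ne_zero l) z),
        Matrix.nonsing_inv_mul_cancel_left _ _ hu, LaxData.eta, kf, smul_neg]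
      abel
    · rw [dirDeriv_eq hs (f.mderiv_frame_y (Circle.coe_ne_zero l) z),
        Matrix.nonsing_inv_mul_cancel_left _ _ hu, LaxData.theta]
      ext i j
      fin_cases i <;> fin_cases j <;> simp [kf, offd, dg]

end LaxData.PlusFlow

end

/-! ### Uniqueness of the Iwasawa decomposition -/

/-- The diagonal entries `p`, `q` of `b' b⁻¹` extend holomorphically to the disc, and unitarity
bounds them by `1` on the circle. At the centre they are `r'/r` and `r/r'`, both at most `1` by the
maximum principle, so `r = r'`. The maximum modulus is thus attained at the centre and `p = q = 1`.
Rows of unit length then leave no room for off-diagonal entries. -/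
lemma eq_one_of_inLoopPlus {b b' : Circle → M2} (hb : InLoopPlus b) (hb' : InLoopPlus b')
    (h : ∀ l, b' l * (b l).adjugate ∈ Matrix.specialUnitaryGroup (Fin 2) ℂ) (l : Circle) :
    b' l * (b l).adjugate = 1 := by
  obtain ⟨e, he, -, hel, r, hr, he0⟩ := hb.extends_holomorphically
  obtain ⟨e', he', -, hel', r', hr', he0'⟩ := hb'.extends_holomorphically
  let p : ℂ → ℂ := fun w => e' w 0 0 * e w 1 1 - e' w 0 1 * e w 1 0
  let q : ℂ → ℂ := fun w => -(e' w 1 0 * e w 0 1) + e' w 1 1 * e w 0 0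
  have hmul : ∀ {f g : ℂ → ℂ}, DiffContOnCl ℂ f (Metric.ball 0 1) →
      DiffContOnCl ℂ g (Metric.ball 0 1) → DiffContOnCl ℂ (fun w => f w * g w) (Metric.ball 0 1) :=
    fun hf hg => ⟨hf.1.mul hg.1, hf.2.mul hg.2⟩
  have hp : DiffContOnCl ℂ p (Metric.ball 0 1) := (hmul (he' 0 0) (he 1 1)).sub (hmul (he' 0 1) (he 1 0))
  have hq : DiffContOnCl ℂ q (Metric.ball 0 1) :=
    (hmul (he' 1 0) (he 0 1)).neg.add (hmul (he' 1 1) (he 0 0))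
  have hbp : ∀ l : Circle, (b' l * (b l).adjugate) 0 0 = p l := fun l => by
    simp [Matrix.mul_apply, Matrix.adjugate_fin_two, Fin.sum_univ_two, p, hel, hel']; ring
  have hbq : ∀ l : Circle, (b' l * (b l).adjugate) 1 1 = q l := fun l => by
    simp [Matrix.mul_apply, Matrix.adjugate_fin_two, Fin.sum_univ_two, q, hel, hel']
  have hnorm : ∀ (l : Circle) i j, ‖(b' l * (b l).adjugate) i j‖ ≤ 1 := fun l i j =>
    entry_norm_bound_of_unitary (Matrix.mem_specialUnitaryGroup_iff.1 (h l)).1 i j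
  have hfr : ∀ {g : ℂ → ℂ}, (∀ l : Circle, ‖g l‖ ≤ 1) → ∀ w ∈ frontier (Metric.ball (0 : ℂ) 1),
      ‖g w‖ ≤ 1 := fun hg w hw => by
    rw [frontier_ball _ one_ne_zero] at hw
    exact hg ⟨w, hw⟩
  have hp1 := fun w hw => Complex.norm_le_of_forall_mem_frontier_norm_le Metric.isBounded_ball hp
    (hfr fun l => hbp l ▸ hnorm l 0 0) (z := w) hw
  have hq1 := fun w hw => Complex.norm_le_of_forall_mem_frontier_norm_le Metric.isBounded_ball hq
    (hfr fun l => hbq l ▸ hnorm l 1 1) (z := w) hw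
  have hz : (0 : ℂ) ∈ closure (Metric.ball (0 : ℂ) 1) := subset_closure (by simp)
  have hp0 : p 0 = (r' / r : ℝ) := by simp [p, he0, he0', div_eq_mul_inv]
  have hq0 : q 0 = (r / r' : ℝ) := by simp [q, he0, he0', div_eq_mul_inv, mul_comm]
  have hrr : r = r' := by
    have h1 := hp1 0 hz
    have h2 := hq1 0 hz
    rw [hp0, Complex.norm_real, Real.norm_of_nonneg (by positivity), div_le_one hr] at h1
    rw [hq0, Complex.norm_real, Real.norm_of_nonneg (by positivity), div_le_one hr'] at h2
    exact le_antisymm h2 h1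
  have hp0' : p 0 = 1 := by rw [hp0, hrr, div_self hr'.ne']; simp
  have hq0' : q 0 = 1 := by rw [hq0, hrr, div_self hr'.ne']; simp
  have hconst : ∀ {g : ℂ → ℂ}, DiffContOnCl ℂ g (Metric.ball 0 1) → g 0 = 1 →
      (∀ w ∈ closure (Metric.ball (0 : ℂ) 1), ‖g w‖ ≤ 1) → g l = 1 := fun {g} hg h0 h1 => by
    have := Complex.eqOn_closedBall_of_isMaxOn_norm hg (fun w hw => by
      simpa [h0] using h1 w (subset_closure hw)) (x := (l : ℂ)) (by simp [Circle.norm_coe])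
    simpa [h0] using this
  have h00 := (hbp l).trans (hconst hp hp0' hp1)
  have h11 := (hbq l).trans (hconst hq hq0' hq1)
  set X := b' l * (b l).adjugate with hX
  have hu : X * star X = 1 := Matrix.mem_unitaryGroup_iff.1 (Matrix.mem_specialUnitaryGroup_iff.1 (h l)).1
  have h1 := congrFun (congrFun hu 0) 0
  have h2 := congrFun (congrFun hu 1) 1
  simp [Matrix.mul_apply, Fin.sum_univ_two, h00, h11, Complex.mul_conj] at h1 h2
  ext i j
  fin_cases i <;> fin_cases j <;> simp [h00, h11, h1, h2]

/-- Two splittings give `b' b⁻¹ = F'⁻¹ F`, a loop that is both positive and unitary, hence trivial.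
-/
theorem Generates.unique {x : Circle → M2} {F F' : ℂ → Circle → M2} (hF : Generates x F)
    (hF' : Generates x F') : F' = F := by
  funext z l
  obtain ⟨h1, b, hb, hFb⟩ := hF z
  obtain ⟨h2, b', hb', hFb'⟩ := hF' z
  have hbb : ∀ l, b l * (b l).adjugate = 1 := fun l => by
    rw [Matrix.mul_adjugate, hb.det_eq_one, one_smul]
  have hl : ∀ l, F' z l * (b' l * (b l).adjugate) = F z l := fun l => by
    rw [← mul_assoc, ← hFb', hFb, mul_assoc, hbb, mul_one]
  have hmem : ∀ l, b' l * (b l).adjugate ∈ Matrix.specialUnitaryGroup (Fin 2) ℂ := fun l => by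
    have h3 : b' l * (b l).adjugate = star (F' z l) * F z l := by
      rw [← hl l, ← mul_assoc,
        Matrix.mem_unitaryGroup_iff'.1 (Matrix.mem_specialUnitaryGroup_iff.1 (h2.mem l)).1, one_mul]
    rw [h3]
    have m1 := Matrix.mem_specialUnitaryGroup_iff.1 (h1.mem l)
    have m2 := Matrix.mem_specialUnitaryGroup_iff.1 (h2.mem l)
    refine Matrix.mem_specialUnitaryGroup_iff.2 ⟨mul_mem (Unitary.star_mem m2.1) m1.1, ?_⟩
    rw [Matrix.det_mul, Matrix.star_eq_conjTranspose, Matrix.det_conjTranspose, m1.2, m2.2]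
    simp
  rw [← hl l, eq_one_of_inLoopPlus hb hb' hmem l, mul_one]

/-! ### Degree one potentials -/

/-- The values at `±1` and `±i` suffice to separate the three coefficients. Twisting makes `ξ₋`,
`ξ₊` off-diagonal and `ξ₀` diagonal; skew-Hermitian values then tie `ξ₊` to `ξ₋`. -/
lemma exists_kf_of_inLoopAlgebra {xm x0 xp : M2} (hx : InLoopAlgebra (laurentLoop xm x0 xp)) :
    ∃ (a b : ℂ) (c : ℝ), xm = offd a b ∧ x0 = dg c ∧ xp = -(offd a b).conjTranspose := by
  have hI : ∃ l : Circle, (l : ℂ) = Complex.I := ⟨⟨Complex.I, by simp [Submonoid.unitSphere]⟩, rfl⟩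
  obtain ⟨i, hi⟩ := hI
  have hneg : ∀ l : Circle, ((-l : Circle) : ℂ) = -(l : ℂ) := fun l => rfl
  have t1 := hx.twisted 1 (-1) (by simp [hneg])
  have ti := hx.twisted i (-i) (by simp [hneg])
  have s1 := (hx.mem 1).1
  have s2 := (hx.mem (-1)).1
  have s3 := (hx.mem i).1
  have s4 := (hx.mem 1).2
  simp only [laurentLoop, tau_eq, hneg, hi, Circle.coe_one, ← Matrix.ext_iff, Fin.forall_fin_two,
    Matrix.conjTranspose_apply, Matrix.trace_fin_two] at t1 ti s1 s2 s3 s4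
  simp at t1 ti s1 s2 s3 s4
  obtain ⟨⟨t00, t01⟩, t10, t11⟩ := t1
  obtain ⟨⟨i00, i01⟩, i10, i11⟩ := ti
  obtain ⟨⟨a00, a01⟩, a10, a11⟩ := s1
  obtain ⟨⟨b00, b01⟩, b10, b11⟩ := s2
  obtain ⟨⟨c00, c01⟩, c10, c11⟩ := s3
  have hII := Complex.I_ne_zero
  have e1 : xm 0 0 + xp 0 0 = 0 := by linear_combination -t00 / 2
  have e2 : xm 0 0 - xp 0 0 = 0 := mul_left_cancel₀ hII (by linear_combination i00 / 2)
  have e3 : xm 1 1 + xp 1 1 = 0 := by linear_combination -t11 / 2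
  have e4 : xm 1 1 - xp 1 1 = 0 := mul_left_cancel₀ hII (by linear_combination i11 / 2)
  have m00 : xm 0 0 = 0 := by linear_combination e1 / 2 + e2 / 2
  have p00 : xp 0 0 = 0 := by linear_combination e1 / 2 - e2 / 2
  have m11 : xm 1 1 = 0 := by linear_combination e3 / 2 + e4 / 2
  have p11 : xp 1 1 = 0 := by linear_combination e3 / 2 - e4 / 2
  have z01 : x0 0 1 = 0 := by linear_combination t01 / 2
  have z10 : x0 1 0 = 0 := by linear_combination t10 / 2
  simp only [m00, p00, m11, p11, z01, z10, map_zero, add_zero, zero_add] at a00 a01 a10 a11 c01 c10 s4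
  have q01 : xp 0 1 = -(starRingEnd ℂ) (xm 1 0) :=
    mul_left_cancel₀ hII (by linear_combination Complex.I * a01 / 2 + c01 / 2)
  have q10 : xp 1 0 = -(starRingEnd ℂ) (xm 0 1) :=
    mul_left_cancel₀ hII (by linear_combination Complex.I * a10 / 2 + c10 / 2)
  have hre : (x0 0 0).re = 0 := by
    have := congrArg Complex.re a00
    simp at this; linarith
  have h00 : x0 0 0 = Complex.I * (x0 0 0).im := by
    apply Complex.ext <;> simp [hre]
  refine ⟨xm 0 1, xm 1 0, (x0 0 0).im, ?_, ?_, ?_⟩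
  · ext i j; fin_cases i <;> fin_cases j <;> simp [offd, m00, m11]
  · ext i j
    fin_cases i <;> fin_cases j <;> simp [dg, z01, z10, ← h00]
    linear_combination s4
  · ext i j; fin_cases i <;> fin_cases j <;> simp [offd, p00, p11, q01, q10]

lemma laurentLoop_eq_kf (a b : ℂ) (c : ℝ) :
    laurentLoop (offd a b) (dg c) (-(offd a b).conjTranspose) = fun l : Circle => kf a b c l := by
  funext l
  simp [laurentLoop, kf, sub_eq_add_neg]

lemma killing_offd (a b : ℂ) : killing (offd a b) (offd a b) = 8 * (a * b) := by
  simp [killing, offd, Matrix.trace_fin_two]; ring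

lemma killing_neg_conjTranspose (a b : ℂ) :
    killing (-(offd a b).conjTranspose) (-(offd a b).conjTranspose) = 8 * star (a * b) := by
  simp [killing, offd, Matrix.trace_fin_two, Matrix.mul_apply]; ring

/-! ### The Lie algebra `su(2)` and Euclidean three-space -/

lemma toE3_add (X Y : M2) : toE3 (X + Y) = toE3 X + toE3 Y := by
  ext i; fin_cases i <;> simp [toE3] <;> ring

lemma toE3_smul (r : ℝ) (X : M2) : toE3 (r • X) = r • toE3 X := by
  ext i; fin_cases i <;> simp [toE3] <;> ring

lemma toE3_sub (X Y : M2) : toE3 (X - Y) = toE3 X - toE3 Y := by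
  ext i; fin_cases i <;> simp [toE3] <;> ring

lemma InSu2.eq {X : M2} (hX : InSu2 X) : X = !![Complex.I * (X 0 0).im, X 0 1;
    -star (X 0 1), -(Complex.I * (X 0 0).im)] := by
  have h00 := congrFun (congrFun hX.1 0) 0
  have h10 := congrFun (congrFun hX.1 1) 0
  have htr := hX.2
  rw [Matrix.trace_fin_two] at htr
  simp at h00 h10
  have hre : (X 0 0).re = 0 := by
    have := congrArg Complex.re h00
    simp at this; linarith
  have h : X 0 0 = Complex.I * (X 0 0).im := by apply Complex.ext <;> simp [hre]
  ext i j
  fin_cases i <;> fin_cases j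
  · exact h
  · rfl
  · simp [h10]
  · simp [← h]; linear_combination htr

lemma InSu2.add {X Y : M2} (hX : InSu2 X) (hY : InSu2 Y) : InSu2 (X + Y) :=
  ⟨by rw [Matrix.conjTranspose_add, hX.1, hY.1, neg_add], by rw [Matrix.trace_add, hX.2, hY.2, add_zero]⟩

lemma InSu2.smul {X : M2} (hX : InSu2 X) (r : ℝ) : InSu2 (r • X) :=
  ⟨by rw [Matrix.conjTranspose_smul, hX.1]; simp, by rw [Matrix.trace_smul, hX.2, smul_zero]⟩

lemma InSu2.sub {X Y : M2} (hX : InSu2 X) (hY : InSu2 Y) : InSu2 (X - Y) := by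
  simpa [sub_eq_add_neg] using hX.add (hY.smul (-1))

lemma InSu2.conj {X g : M2} (hX : InSu2 X) (hg : g * g.conjTranspose = 1) : InSu2 (g * X * g⁻¹) := by
  have hi : g⁻¹ = g.conjTranspose := Matrix.inv_eq_right_inv hg
  have hg' : g.conjTranspose * g = 1 := mul_eq_one_comm.1 hg
  rw [hi]
  refine ⟨?_, ?_⟩
  · simp [Matrix.conjTranspose_mul, hX.1, mul_assoc]
  · rw [Matrix.trace_mul_comm, ← mul_assoc, hg', one_mul, hX.2]

lemma InSu2.commutator {X Y : M2} (hX : InSu2 X) (hY : InSu2 Y) : InSu2 (X * Y - Y * X) := by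
  refine ⟨?_, ?_⟩
  · rw [Matrix.conjTranspose_sub, Matrix.conjTranspose_mul, Matrix.conjTranspose_mul, hX.1, hY.1]
    noncomm_ring
  · rw [Matrix.trace_sub, Matrix.trace_mul_comm, sub_self]

lemma inSu2_kf (a b : ℂ) (c : ℝ) (l : Circle) : InSu2 (kf a b c l) :=
  ⟨kf_conjTranspose a b c l, trace_kf a b c l⟩

lemma inSu2_e1 : InSu2 e1 := by
  refine ⟨?_, by simp [e1, Matrix.trace_fin_two]; ring⟩
  ext i j
  fin_cases i <;> fin_cases j <;> simp [e1] <;> ring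

lemma inner_toE3 {X Y : M2} (hX : InSu2 X) (hY : InSu2 Y) :
    inner ℝ (toE3 X) (toE3 Y) = -2 * (X * Y).trace.re := by
  rw [hX.eq, hY.eq]
  simp [toE3, PiLp.inner_apply, Fin.sum_univ_three, Matrix.trace_fin_two]
  ring

lemma inner_toE3_conj {X Y g : M2} (hX : InSu2 X) (hY : InSu2 Y) (hg : g * g.conjTranspose = 1) :
    inner ℝ (toE3 (g * X * g⁻¹)) (toE3 (g * Y * g⁻¹)) = inner ℝ (toE3 X) (toE3 Y) := by
  rw [inner_toE3 (hX.conj hg) (hY.conj hg), inner_toE3 hX hY]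
  have hi : g⁻¹ = g.conjTranspose := Matrix.inv_eq_right_inv hg
  have hg' : g.conjTranspose * g = 1 := mul_eq_one_comm.1 hg
  have : g * X * g⁻¹ * (g * Y * g⁻¹) = g * (X * Y) * g.conjTranspose := by
    rw [hi]
    calc _ = g * X * (g.conjTranspose * g) * Y * g.conjTranspose := by noncomm_ring
      _ = _ := by rw [hg']; noncomm_ring
  rw [this, Matrix.trace_mul_comm, ← mul_assoc, hg', one_mul]

/-- Cayley--Hamilton for a traceless matrix, where `det X` is a quarter of the squared Euclidean
norm. -/
lemma InSu2.mul_self {X : M2} (hX : InSu2 X) : X * X = (-(‖toE3 X‖ / 2 : ℝ) ^ 2 : ℂ) • (1 : M2) := by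
  have h : ‖toE3 X‖ ^ 2 = 4 * (X 0 0).im ^ 2 + 4 * (X 0 1).re ^ 2 + 4 * (X 0 1).im ^ 2 := by
    simp [EuclideanSpace.norm_sq_eq, Fin.sum_univ_three, toE3]; ring
  have h2 : (-(‖toE3 X‖ / 2 : ℝ) ^ 2 : ℂ) =
      -((X 0 0).im : ℂ) ^ 2 - ((X 0 1).re : ℂ) ^ 2 - ((X 0 1).im : ℂ) ^ 2 := by
    have h' : (‖toE3 X‖ / 2) ^ 2 = (X 0 0).im ^ 2 + (X 0 1).re ^ 2 + (X 0 1).im ^ 2 := by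
      rw [div_pow, h]; ring
    have h'' := congrArg (Complex.ofReal) h'
    push_cast at h'' ⊢
    rw [h'']; ring
  rw [h2]
  have h01 := Complex.mul_conj (X 0 1)
  rw [Complex.normSq_apply] at h01
  push_cast at h01
  have hI := Complex.I_sq
  generalize hY : X = Y at *
  rw [hX.eq]
  ext i j
  fin_cases i <;> fin_cases j <;> simp [Matrix.mul_apply, Fin.sum_univ_two]
  · linear_combination ((Y 0 0).im : ℂ) ^ 2 * hI - h01
  · ring
  · ring
  · linear_combination ((Y 0 0).im : ℂ) ^ 2 * hI - h01

lemma toE3_ne_zero {X : M2} (hX : InSu2 X) (h : X ≠ 0) : ‖toE3 X‖ ≠ 0 := by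
  rw [norm_ne_zero_iff]
  intro h0
  have e0 := congrArg (fun v : E3 => v 0) h0
  have e1 := congrArg (fun v : E3 => v 1) h0
  have e2 := congrArg (fun v : E3 => v 2) h0
  simp [toE3] at e0 e1 e2
  have h1 : X 0 1 = 0 := Complex.ext e1 e2
  apply h
  rw [hX.eq, e0, h1]
  ext i j
  fin_cases i <;> fin_cases j <;> simp

lemma exp_smul_inSu2 {X : M2} (hX : InSu2 X) {w : ℝ} (hw : w ≠ 0)
    (hXX : X * X = (-(w : ℂ) ^ 2) • (1 : M2)) (x : ℝ) : NormedSpace.exp ((x : ℂ) • X) =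
      (Real.cos (w * x) : ℂ) • (1 : M2) + (Real.sin (w * x) / w : ℂ) • X := by
  have hw' : (w : ℂ) ≠ 0 := by exact_mod_cast hw
  refine eq_of_mderiv_left (f := fun x : ℝ => NormedSpace.exp ((x : ℂ) • X)) (M := fun _ => X)
    (g := fun x => (Real.cos (w * x) : ℂ) • (1 : M2) + (Real.sin (w * x) / w : ℂ) • X)
    (mderiv_exp_smul X) (fun t => ?_) (fun _ => hX.2) (by simp) (by simp) x
  have h1 : HasDerivAt (fun x => w * x) w t := by simpa using (hasDerivAt_id t).const_mul w
  have hc := h1.cos.ofReal_comp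
  have hs := h1.sin.ofReal_comp.div_const (w : ℂ)
  refine ((MDeriv.smul hc (mderiv_const 1)).add (MDeriv.smul hs (mderiv_const X))).congr_deriv ?_
  rw [mul_add, mul_smul_comm, mul_smul_comm, hXX, mul_one, smul_smul, smul_zero, smul_zero,
    add_zero, add_zero, add_comm]
  congr 2
  · push_cast; field_simp
  · push_cast; field_simp

lemma exp_mul_conjTranspose {X : M2} (hX : InSu2 X) (x : ℝ) :
    NormedSpace.exp ((x : ℂ) • X) * (NormedSpace.exp ((x : ℂ) • X)).conjTranspose = 1 := by
  rw [← Matrix.exp_conjTranspose, Matrix.conjTranspose_smul, hX.1, ← Matrix.exp_add_of_commute]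
  · simp
  · simp only [RCLike.star_def, Complex.conj_ofReal, smul_neg]
    exact (Commute.refl _).neg_right

lemma rotation_eq (p d : E3) (θ : ℝ) (v : E3) : rotation p d θ v = p + rotation 0 d θ (v - p) := by
  simp [rotation, add_assoc]

lemma cross_smul (r : ℝ) (u v : E3) : cross (r • u) v = r • cross u v := by
  simp [cross]

/-- Rodrigues' formula in half-angle form, before normalisation: `C` stands for the cosine of half
the angle, and `T ‖X‖ / 2` for its sine. In this generality it is a polynomial identity. -/
lemma toE3_conj_eq {X Z : M2} (hX : InSu2 X) (hZ : InSu2 Z) (C T : ℝ) :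
    toE3 (((C : ℂ) • (1 : M2) + (T : ℂ) • X) * Z * ((C : ℂ) • (1 : M2) + (T : ℂ) • X).conjTranspose) =
      (C ^ 2 - T ^ 2 * ((X 0 0).im ^ 2 + (X 0 1).re ^ 2 + (X 0 1).im ^ 2)) • toE3 Z +
        (C * T) • cross (toE3 X) (toE3 Z) +
        (T ^ 2 / 2 * inner ℝ (toE3 X) (toE3 Z)) • toE3 X := by
  generalize hx : (X 0 0).im = p
  generalize hz : (Z 0 0).im = p'
  generalize hx1 : X 0 1 = q
  generalize hz1 : Z 0 1 = q'
  rw [hX.eq, hZ.eq, hx, hz, hx1, hz1]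
  ext i
  fin_cases i <;>
    simp [toE3, cross, crossProduct, PiLp.inner_apply, Fin.sum_univ_three, Matrix.mul_apply,
      Fin.sum_univ_two] <;> ring

/-- The adjoint action of a one-parameter group is by rotations. -/
lemma toE3_exp_conj {X : M2} (hX : InSu2 X) (h0 : X ≠ 0) {Z : M2} (hZ : InSu2 Z) (x : ℝ) :
    toE3 (NormedSpace.exp ((x : ℂ) • X) * Z * (NormedSpace.exp ((x : ℂ) • X))⁻¹) =
      rotation 0 (‖toE3 X‖⁻¹ • toE3 X) (‖toE3 X‖ * x) (toE3 Z) := by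
  set w := ‖toE3 X‖ / 2 with hw
  have hw0 : w ≠ 0 := div_ne_zero (toE3_ne_zero hX h0) two_ne_zero
  have hn : ‖toE3 X‖ = 2 * w := by rw [hw]; ring
  rw [Matrix.inv_eq_right_inv (exp_mul_conjTranspose hX x),
    exp_smul_inSu2 hX hw0 hX.mul_self, hn, rotation, sub_zero, zero_add, mul_assoc 2 w x,
    Real.cos_two_mul', Real.sin_two_mul]
  have hcs := Real.sin_sq_add_cos_sq (w * x)
  set C := Real.cos (w * x)
  set S := Real.sin (w * x)
  obtain ⟨T, hT⟩ : ∃ T, S = T * w := ⟨S / w, by field_simp⟩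
  have hT' : (S / w : ℂ) = (T : ℝ) := by
    rw [hT, Complex.ofReal_mul]
    exact mul_div_cancel_right₀ _ (by exact_mod_cast hw0)
  rw [hT', hT]
  have h1 : 1 - (C ^ 2 - (T * w) ^ 2) = 2 * T ^ 2 * w ^ 2 := by rw [hT] at hcs; linarith
  have hXX : w ^ 2 = (X 0 0).im ^ 2 + (X 0 1).re ^ 2 + (X 0 1).im ^ 2 := by
    rw [hw, div_pow]
    simp [EuclideanSpace.norm_sq_eq, Fin.sum_univ_three, toE3]; ring
  rw [h1, toE3_conj_eq hX hZ, ← hXX, cross_smul, inner_smul_left]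
  ext i
  simp
  field_simp

/-! ### Symmetries of the associated family -/

lemma SmoothLoop.mderiv_loopDeriv {g : Circle → M2} (hg : SmoothLoop g) (m : Circle) :
    MDeriv (fun t : ℝ => g (m * Circle.exp t)) (loopDeriv g m) 0 := by
  obtain ⟨s, rfl⟩ := Circle.exp_surjective m
  intro i j
  have h : Differentiable ℝ fun t : ℝ => g (Circle.exp s * Circle.exp t) i j := by
    simp only [← Circle.exp_add]
    exact ((hg i j).differentiable (by simp)).comp (differentiable_id.const_add s)
  exact (h 0).hasDerivAt

lemma loopDeriv_eq {g : Circle → M2} {m : Circle} {X : M2}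
    (h : MDeriv (fun t : ℝ => g (m * Circle.exp t)) X 0) : loopDeriv g m = X := by
  ext i j
  exact (h i j).deriv

lemma smoothLoop_expLoop (a b : ℂ) (c : ℝ) (z : ℂ) :
    SmoothLoop (expLoop (fun l : Circle => kf a b c l) z) :=
  MSmooth.exp (MSmooth.smul contDiff_const (msmooth_kf_exp a b c))

/-- `Φ_m` is multiplicative because `(gh)' (gh)⁻¹ = g' g⁻¹ + Ad g (h' h⁻¹)`. -/
lemma affineAct_Phi_mul {g h : Circle → M2} (hg : SmoothLoop g) (hh : SmoothLoop h) {m : Circle}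
    (hu : IsUnit (h m).det) (X : M2) :
    affineAct (Phi m fun l => g l * h l) X = affineAct (Phi m g) (affineAct (Phi m h) X) := by
  have h1 : loopDeriv (fun l => g l * h l) m = loopDeriv g m * h m + g m * loopDeriv h m :=
    loopDeriv_eq (((hg.mderiv_loopDeriv m).mul (hh.mderiv_loopDeriv m)).congr_deriv (by simp))
  simp only [affineAct, Phi, h1, Matrix.mul_inv_rev]
  have h2 : h m * (h m)⁻¹ = 1 := Matrix.mul_nonsing_inv _ hu
  rw [add_mul, mul_assoc (loopDeriv g m), ← mul_assoc (h m), h2]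
  noncomm_ring

/-- The loop `E` is left general so that it can be the exponential of `ξ` and also that of the
second symmetry, available when `ξ` vanishes at a point of the circle. -/
lemma symBobenko_of_eq_mul {F : ℂ → Circle → M2} (hF : ∀ z, InLoopSU2 (F z)) {E : Circle → M2}
    (hE : SmoothLoop E) {z z' : ℂ} (h : F z' = fun l => E l * F z l) {H : ℝ} (hH : H ≠ 0) (ε : ℝ)
    (l : Circle) : symBobenko H ε F l z' =
      (-(1 / (2 * H))) • affineAct (Phi l E) ((-(2 * H)) • symBobenko H ε F l z) := by
  have hu : IsUnit (F z l).det := by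
    rw [(Matrix.mem_specialUnitaryGroup_iff.1 ((hF z).mem l)).2]; exact isUnit_one
  rw [symBobenko, h, affineAct_Phi_mul hE (hF z).smooth hu, symBobenko, smul_smul]
  rw [show -(2 * H) * -(1 / (2 * H)) = 1 by field_simp, one_smul]

lemma InLoopSU2.inSu2_loopDeriv {g : Circle → M2} (hg : InLoopSU2 g) (m : Circle) :
    InSu2 (loopDeriv g m * (g m)⁻¹) := by
  have hd := hg.smooth.mderiv_loopDeriv m
  have hgm : ∀ l, g l * (g l).conjTranspose = 1 := fun l =>
    Matrix.mem_unitaryGroup_iff.1 (Matrix.mem_specialUnitaryGroup_iff.1 (hg.mem l)).1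
  have hdet : ∀ l, (g l).det = 1 := fun l => (Matrix.mem_specialUnitaryGroup_iff.1 (hg.mem l)).2
  have hi : (g m)⁻¹ = (g m).conjTranspose := Matrix.inv_eq_right_inv (hgm m)
  have hi' : (g m)⁻¹ = (g m).adjugate := by
    refine Matrix.inv_eq_right_inv ?_
    rw [Matrix.mul_adjugate, hdet, one_smul]
  have h1 := (hd.mul hd.conjTranspose).unique ((mderiv_const 1).congr fun t => hgm _)
  have h2 := hd.det.unique ((hasDerivAt_const (0 : ℝ) (1 : ℂ)).congr_of_eventuallyEq
    (.of_forall fun t => hdet _))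
  simp only [Circle.exp_zero, mul_one] at h1 h2
  refine ⟨?_, ?_⟩
  · rw [hi, Matrix.conjTranspose_mul, Matrix.conjTranspose_conjTranspose]
    exact eq_neg_of_add_eq_zero_right h1
  · rw [hi', Matrix.trace_mul_comm, h2]

lemma inSu2_symBobenko {F : ℂ → Circle → M2} (hF : ∀ z, InLoopSU2 (F z)) (H ε : ℝ) (l : Circle)
    (z : ℂ) : InSu2 (symBobenko H ε F l z) :=
  (((inSu2_e1.smul (-ε)).conj (Matrix.mem_unitaryGroup_iff.1
    (Matrix.mem_specialUnitaryGroup_iff.1 ((hF z).mem l)).1)).add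
      ((hF z).inSu2_loopDeriv l)).smul _

lemma mderiv_kf (a b : ℂ) (c : ℝ) (m : Circle) :
    MDeriv (fun t : ℝ => kf a b c (m * Circle.exp t : Circle))
      ((-(Complex.I * (m : ℂ)⁻¹)) • offd a b - (Complex.I * m) • (offd a b).conjTranspose) 0 := by
  have hm := Circle.coe_ne_zero m
  have h1 : HasDerivAt (fun t : ℝ => ((m * Circle.exp t : Circle) : ℂ)) (Complex.I * m) 0 := by
    simp only [Circle.coe_mul, Circle.coe_exp]
    have h := (((hasDerivAt_id (0 : ℝ)).ofReal_comp.mul_const Complex.I).cexp.const_mul (m : ℂ))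
    simpa [mul_comm] using h
  have h2 := h1.inv (Circle.coe_ne_zero _)
  refine (((MDeriv.smul h2 (mderiv_const (offd a b))).add (mderiv_const (dg c))).sub
    (MDeriv.smul h1 (mderiv_const (offd a b).conjTranspose))).congr_deriv ?_
  simp only [smul_zero, add_zero, Circle.exp_zero, mul_one]
  congr 2
  field_simp

/-- Polarised Cayley--Hamilton: `XV + VX = tr (XV)` for traceless `2 × 2` matrices. -/
lemma mul_comm_of_trace_mul {X V : M2} (hX : X.trace = 0) (hV : V.trace = 0)
    (h : (X * V).trace = 0) : V * X = -(X * V) := by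
  rw [Matrix.trace_fin_two] at hX hV h
  have hx : X 1 1 = -X 0 0 := by linear_combination hX
  have hv : V 1 1 = -V 0 0 := by linear_combination hV
  simp only [Matrix.mul_apply, Fin.sum_univ_two, hx, hv] at h
  ext i j
  fin_cases i <;> fin_cases j <;> simp [Matrix.mul_apply, Fin.sum_univ_two, hx, hv] <;>
    first | linear_combination h | ring

/-- At the points where `⟨ξ, ξ'⟩ = 0`, the one-parameter group acts by rotations. -/
theorem actsByRotations_kf {a b : ℂ} {c : ℝ} {m : Circle}
    (h : (m : ℂ) ^ 4 * star (a * b) = a * b) (h0 : kf a b c m ≠ 0) :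
    ActsByRotations fun x : ℝ => Phi m (expLoop (fun l : Circle => kf a b c l) x) := by
  have hm := Circle.coe_ne_zero m
  set X := kf a b c m with hXdef
  set V := (-(Complex.I * (m : ℂ)⁻¹)) • offd a b - (Complex.I * m) • (offd a b).conjTranspose with hVdef
  have hX : InSu2 X := inSu2_kf a b c m
  have hV : InSu2 V := by
    have := star_circle m
    refine ⟨?_, by simp [hVdef, offd, Matrix.trace_fin_two]⟩
    ext i j
    fin_cases i <;> fin_cases j <;> simp [hVdef, offd, this]
  -- `V` is the derivative of `ξ` at `m`, and `tr (XV)` is a multiple of `m²⟨ξ₊, ξ₊⟩ - m⁻²⟨ξ₋, ξ₋⟩`.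
  have htr : (X * V).trace = 0 := by
    simp [hXdef, hVdef, kf, offd, dg, Matrix.trace_fin_two, Matrix.mul_apply]
    simp at h
    field_simp
    linear_combination (2 * Complex.I) * h
  have hVX := mul_comm_of_trace_mul hX.2 hV.2 htr
  set w := ‖toE3 X‖ / 2 with hw
  have hw0 : w ≠ 0 := div_ne_zero (toE3_ne_zero hX h0) two_ne_zero
  have hwc : (w : ℂ) ≠ 0 := by exact_mod_cast hw0
  have hXX : X * X = (-(w : ℂ) ^ 2) • (1 : M2) := hX.mul_self
  -- As `X` and `V` anticommute and `X² = -w²`, one has `[XV, X] = 2w²V`. This normalisation gives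
  -- `V = [Y, X]`: to first order, moving `m` along the circle conjugates `X` by `exp (tY)`.
  set Y : M2 := (1 / (2 * w ^ 2) : ℝ) • (X * V) with hYdef
  have hY : InSu2 Y := by
    refine InSu2.smul ⟨?_, htr⟩ _
    rw [Matrix.conjTranspose_mul, hX.1, hV.1, neg_mul_neg, hVX]
  have hYX : Y * X - X * Y = V := by
    rw [hYdef, smul_mul_assoc, mul_smul_comm, mul_assoc, hVX, mul_neg, ← mul_assoc, hXX,
      smul_mul_assoc, one_mul, ← smul_sub]
    ext i j
    simp
    field_simp
    ring
  -- The curve `xξ` may be replaced by the conjugates of `xX` under `exp (tY)`, which have the same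
  -- first order jet. Their exponentials are the conjugates of `E`, with derivative `[Y, E]`.
  have hE : ∀ x : ℝ, loopDeriv (expLoop (fun l : Circle => kf a b c l) x) m =
      Y * NormedSpace.exp ((x : ℂ) • X) - NormedSpace.exp ((x : ℂ) • X) * Y := by
    intro x
    set E := NormedSpace.exp ((x : ℂ) • X) with hEdef
    apply loopDeriv_eq
    have h1 := (mderiv_exp_smul Y 0)
    have h2 : MDeriv (fun t : ℝ => NormedSpace.exp (-((t : ℂ) • Y))) (-Y) 0 := by
      have := mderiv_exp_smul (-Y) 0
      simpa using this
    simp only [Complex.ofReal_zero, zero_smul, NormedSpace.exp_zero, mul_one] at h1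
    have key : ∀ Z : M2, MDeriv (fun t : ℝ => NormedSpace.exp ((t : ℂ) • Y) * Z *
        NormedSpace.exp (-((t : ℂ) • Y))) (Y * Z - Z * Y) 0 := fun Z =>
      ((h1.mul_const Z).mul h2).congr_deriv (by simp; noncomm_ring)
    have h3 : MDeriv (fun t : ℝ => (x : ℂ) • kf a b c (m * Circle.exp t : Circle))
      ((x : ℂ) • V) 0 := (mderiv_kf a b c m).const_smul (x : ℂ)
    refine ((key ((x : ℂ) • X)).congr_deriv ?_).exp_congr h3 (by simp [hXdef])
      ((key E).congr fun t => ?_)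
    · rw [mul_smul_comm (x : ℂ) Y, smul_mul_assoc (x : ℂ) X, ← smul_sub, hYX]
    · rw [hEdef]
      have := Matrix.exp_conj (NormedSpace.exp ((t : ℂ) • Y)) ((x : ℂ) • X) (Matrix.isUnit_exp _)
      rwa [← Matrix.exp_neg] at this
  refine ⟨toE3 Y, ‖toE3 X‖⁻¹ • toE3 X, ‖toE3 X‖, ?_, toE3_ne_zero hX h0, fun x Z hZ => ?_⟩
  · rw [norm_smul, norm_inv, norm_norm, inv_mul_cancel₀ (toE3_ne_zero hX h0)]
  -- By `hE`, `E' E⁻¹ = Y - Ad E Y`, so the affine action is `Z ↦ Y + Ad E (Z - Y)`, which fixes the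
  -- line through `Y` in the direction `X`.
  · rw [rotation_eq, ← toE3_sub, ← toE3_exp_conj hX h0 (hZ.sub hY), ← toE3_add]
    congr 1
    simp only [affineAct, Phi, hE]
    simp only [expLoop, ← hXdef]
    set E := NormedSpace.exp ((x : ℂ) • X)
    have hEE : E * E⁻¹ = 1 := Matrix.mul_nonsing_inv _ ((Matrix.isUnit_iff_isUnit_det _).1 (Matrix.isUnit_exp _))
    rw [sub_mul, mul_assoc Y, hEE]
    noncomm_ring

lemma cross_smul_right (r : ℝ) (u v : E3) : cross u (r • v) = r • cross u v := by
  simp [cross]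

lemma smul_rotation (k : ℝ) (p d : E3) (θ : ℝ) (v : E3) :
    k • rotation p d θ v = rotation (k • p) d θ (k • v) := by
  simp only [rotation, ← smul_sub, cross_smul_right, inner_smul_right]
  module

/-- Rotation by `θ` corresponds to translating the domain by `(θ / s) v`. The direction `v` is real
in general and imaginary when `ξ` vanishes at the point considered. -/
lemma isSurfaceOfRevolution_of_symmetry {P : ℝ → M2 × M2} (hP : ActsByRotations P) {H : ℝ}
    (hH : H ≠ 0) {S : ℂ → M2} (hS : ∀ z, InSu2 (S z)) (v : ℂ)
    (h : ∀ (x : ℝ) z, S (z + x * v) = (-(1 / (2 * H))) • affineAct (P x) ((-(2 * H)) • S z)) :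
    IsSurfaceOfRevolution fun z => toE3 (S z) := by
  obtain ⟨p, d, s, hd, hs, hrot⟩ := hP
  refine ⟨(-(1 / (2 * H))) • p, d, hd, fun θ => ⟨Equiv.addRight (((θ / s : ℝ) : ℂ) * v), ?_, ?_,
    fun z => ?_⟩⟩
  · exact contDiff_id.add contDiff_const
  · exact contDiff_id.add contDiff_const
  · simp only [Equiv.coe_addRight]
    rw [h, toE3_smul, hrot _ _ ((hS z).smul _), toE3_smul, smul_rotation, smul_smul,
      mul_div_cancel₀ _ hs, show -(1 / (2 * H)) * -(2 * H) = 1 by field_simp, one_smul]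

/-! ### Geometry of the Sym--Bobenko surfaces -/

lemma hasDerivAt_line {f : ℂ → ℂ} {f' : ℂ →L[ℝ] ℂ} {z v : ℂ} (hf : HasFDerivAt f f' z) :
    HasDerivAt (fun r : ℝ => f (z + r * v)) (f' v) 0 := by
  have h2 : HasDerivAt (fun t : ℝ => z + t * v) v 0 := by
    simpa using ((hasDerivAt_id (0 : ℝ)).ofReal_comp.mul_const v).const_add z
  exact HasFDerivAt.comp_hasDerivAt (0 : ℝ) (f := fun t : ℝ => z + t * v) (by simpa using hf) h2

/-- Mixed partial derivatives commute. -/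
lemma hasDerivAt_deriv_snd {Q : ℂ × ℝ → ℂ} (hQ : ContDiff ℝ ∞ Q) {D : ℝ → ℂ} {z v : ℂ} {s : ℝ}
    (h : ∀ t, HasDerivAt (fun r : ℝ => Q (z + r * v, t)) (D t) 0) :
    HasDerivAt (fun r : ℝ => deriv (fun t => Q (z + r * v, t)) s) (deriv D s) 0 := by
  have hd : Differentiable ℝ Q := hQ.differentiable (by simp)
  have hd2 : Differentiable ℝ (fderiv ℝ Q) := 
    (hQ.fderiv_right (m := ∞) le_rfl).differentiable (by simp)
  have h1 : ∀ w t, HasDerivAt (fun t => Q (w, t)) (fderiv ℝ Q (w, t) (0, 1)) t := fun w t =>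
    (hd (w, t)).hasFDerivAt.comp_hasDerivAt t ((hasDerivAt_const t w).prodMk (hasDerivAt_id t))
  have hl : HasDerivAt (fun r : ℝ => z + r * v) v 0 := by
    simpa using ((hasDerivAt_id (0 : ℝ)).ofReal_comp.mul_const v).const_add z
  have h2 : ∀ t, D t = fderiv ℝ Q (z, t) (v, 0) := fun t => by
    refine (h t).unique ?_
    exact HasFDerivAt.comp_hasDerivAt (0 : ℝ) (f := fun r : ℝ => (z + r * v, t))
      (by simpa using (hd (z, t)).hasFDerivAt) (hl.prodMk (hasDerivAt_const _ t))
  have h3 : deriv D s = fderiv ℝ (fderiv ℝ Q) (z, s) (0, 1) (v, 0) := by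
    rw [funext h2]
    refine HasDerivAt.deriv ?_
    have := (hd2 (z, s)).hasFDerivAt.comp_hasDerivAt s
      ((hasDerivAt_const s z).prodMk (hasDerivAt_id s))
    simpa using this.clm_apply (hasDerivAt_const s ((v, 0) : ℂ × ℝ))
  have hsymm : IsSymmSndFDerivAt ℝ Q (z, s) := hQ.contDiffAt.isSymmSndFDerivAt (by
    simp
    exact WithTop.coe_le_coe.2 (le_top : (2 : ℕ∞) ≤ ⊤))
  rw [h3, hsymm.eq]
  simp only [(h1 _ _).deriv]
  have := HasFDerivAt.comp_hasDerivAt (0 : ℝ) (f := fun r : ℝ => (z + r * v, s))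
      (by simpa using (hd2 (z, s)).hasFDerivAt) (hl.prodMk (hasDerivAt_const _ s))
  simpa using this.clm_apply (hasDerivAt_const (0 : ℝ) ((0, 1) : ℂ × ℝ))

lemma toE3_contDiff {S : ℂ → M2} (hS : MSmooth S) : ContDiff ℝ ∞ fun z => toE3 (S z) := by
  rw [contDiff_euclidean]
  intro i
  have him : ∀ i j, ContDiff ℝ ∞ fun z => (S z i j).im := fun i j =>
    Complex.imCLM.contDiff.comp (hS i j)
  have hre : ∀ i j, ContDiff ℝ ∞ fun z => (S z i j).re := fun i j =>
    Complex.reCLM.contDiff.comp (hS i j)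
  fin_cases i
  · exact contDiff_const.mul (him 0 0)
  · exact contDiff_const.mul (hre 0 1)
  · exact contDiff_const.mul (him 0 1)

lemma fderiv_toE3 {S : ℂ → M2} (hS : MSmooth S) {z v : ℂ} {X : M2}
    (h : MDeriv (fun t : ℝ => S (z + t * v)) X 0) :
    fderiv ℝ (fun z => toE3 (S z)) z v = toE3 X := by
  have h1 : HasDerivAt (fun t : ℝ => toE3 (S (z + t * v))) (toE3 X) 0 := by
    rw [hasDerivAt_iff_hasFDerivAt, ← hasFDerivWithinAt_univ, hasFDerivWithinAt_euclidean]
    intro i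
    have him : ∀ i j, HasDerivAt (fun t : ℝ => (S (z + t * v) i j).im) (X i j).im 0 := fun i j =>
      Complex.imCLM.hasFDerivAt.comp_hasDerivAt (0 : ℝ) (h i j)
    have hre : ∀ i j, HasDerivAt (fun t : ℝ => (S (z + t * v) i j).re) (X i j).re 0 := fun i j =>
      Complex.reCLM.hasFDerivAt.comp_hasDerivAt (0 : ℝ) (h i j)
    fin_cases i
    · exact ((him 0 0).const_mul 2).hasFDerivAt.hasFDerivWithinAt.congr_fderiv
        (by ext; simp [toE3])
    · exact ((hre 0 1).const_mul 2).hasFDerivAt.hasFDerivWithinAt.congr_fderiv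
        (by ext; simp [toE3])
    · exact ((him 0 1).const_mul 2).hasFDerivAt.hasFDerivWithinAt.congr_fderiv
        (by ext; simp [toE3])
  have h2 : HasDerivAt (fun t : ℝ => z + t * v) v 0 := by
    simpa using ((hasDerivAt_id (0 : ℝ)).ofReal_comp.mul_const v).const_add z
  have h3 : HasFDerivAt (fun z => toE3 (S z)) (fderiv ℝ (fun z => toE3 (S z)) z)
      (z + (0 : ℝ) * v) := by
    simpa using ((toE3_contDiff hS).differentiable (by simp) z).hasFDerivAt
  have h4 : HasDerivAt ((fun z => toE3 (S z)) ∘ fun t : ℝ => z + t * v) (toE3 X) 0 := h1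
  exact (h3.comp_hasDerivAt (0 : ℝ) h2).unique h4

/-- Tangent vectors in the moving frame. -/
def tang (H : ℝ) (w : ℂ) : M2 := !![0, Complex.I / H * star w; Complex.I / H * w, 0]

lemma inSu2_tang (H : ℝ) (w : ℂ) : InSu2 (tang H w) := by
  refine ⟨?_, by simp [tang, Matrix.trace_fin_two]⟩
  ext i j
  fin_cases i <;> fin_cases j <;> simp [tang, neg_div]

lemma inner_tang (H : ℝ) (w w' : ℂ) :
    inner ℝ (toE3 (tang H w)) (toE3 (tang H w')) = 4 / H ^ 2 * (w * star w').re := by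
  rw [inner_toE3 (inSu2_tang H w) (inSu2_tang H w')]
  have : (tang H w * tang H w').trace = ((-1 / H ^ 2 : ℝ) : ℂ) * (star w * w' + w * star w') := by
    simp [tang, Matrix.trace_fin_two]
    linear_combination (1 / (H : ℂ) ^ 2) * ((starRingEnd ℂ) w * w' + w * (starRingEnd ℂ) w') * Complex.I_sq
  rw [this, Complex.re_ofReal_mul]
  simp
  ring

lemma toE3_e1 : toE3 e1 = !₂[1, 0, 0] := by
  ext i; fin_cases i <;> simp [toE3, e1]

lemma inner_toE3_e1 (X : M2) : inner ℝ (toE3 X) (toE3 e1) = 2 * (X 0 0).im := by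
  rw [toE3_e1]
  simp [toE3, PiLp.inner_apply, Fin.sum_univ_three]

/-- The coordinate of `∂f/∂x` in the moving frame. -/
def tangCoord (ε : ℝ) (A B : ℂ) (l : ℂ) : ℂ := if ε = 1 then l⁻¹ * B else l * star A

lemma kf_eq (A B : ℂ) (c : ℝ) (l : ℂ) : kf A B c l = !![Complex.I * c, l⁻¹ * A - l * star B;
    l⁻¹ * B - l * star A, -(Complex.I * c)] := by
  ext i j
  fin_cases i <;> fin_cases j <;> simp [kf, offd, dg]

/-- The left side is the derivative of the surface, pulled back by the frame. Bracketing with `e1`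
and differentiating in `λ` both multiply the off-diagonal entries of the `λ⁻¹` and `λ` terms by
`±i`. For each sign `ε` they reinforce each other on one of `A`, `B` and cancel on the other. -/
lemma tang_eq {H ε : ℝ} (hH : H ≠ 0) (hε : ε ∈ ({1, -1} : Set ℝ)) (A B : ℂ) (c : ℝ) (l : Circle) :
    (-(1 / (2 * H))) • (kf A B c l * ((-ε) • e1) - ((-ε) • e1) * kf A B c l +
      ((-(Complex.I * (l : ℂ)⁻¹)) • offd A B - (Complex.I * l) • (offd A B).conjTranspose)) =
    tang H (tangCoord ε A B l) := by
  have hl := star_circle l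
  have hl0 := Circle.coe_ne_zero l
  have hH' : (H : ℂ) ≠ 0 := by exact_mod_cast hH
  rcases hε with rfl | rfl
  · ext i j
    fin_cases i <;> fin_cases j <;>
      simp [tang, tangCoord, kf_eq, offd, e1, hl] <;>
      field_simp <;> ring_nf <;> simp
  · have : ¬ ((-1 : ℝ) = 1) := by norm_num
    ext i j
    fin_cases i <;> fin_cases j <;>
      simp [tang, tangCoord, kf_eq, offd, e1, hl, this] <;>
      field_simp <;> ring_nf <;> simp

/-- The coefficient `B` enters linearly and `A` conjugate-linearly, so passing from `∂x` to `∂y` is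
a quarter turn, in opposite senses for the two families. This is the source of conformality. -/
lemma tangCoord_I {ε : ℝ} (hε : ε ∈ ({1, -1} : Set ℝ)) (A B l : ℂ) :
    tangCoord ε (Complex.I * A) (Complex.I * B) l = ε * Complex.I * tangCoord ε A B l := by
  rcases hε with rfl | rfl
  · simp [tangCoord]; ring
  · have : ¬ ((-1 : ℝ) = 1) := by norm_num
    simp [tangCoord, this]; ring

/-- This computes the normal part of `f_xx + f_yy`. The derivatives `w₁`, `w₂` of the coordinates
are arbitrary, since they contribute only off-diagonal, that is tangential, terms. -/
lemma commutator_tang_add {H ε : ℝ} (hε : ε ∈ ({1, -1} : Set ℝ)) (A B : ℂ) (c : ℝ) (l : Circle)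
    (w₁ w₂ : ℂ) :
    ((kf A B c l * tang H (tangCoord ε A B l) - tang H (tangCoord ε A B l) * kf A B c l +
        tang H w₁) 0 0).im +
      ((kf (Complex.I * A) (Complex.I * B) 0 l * tang H (ε * Complex.I * tangCoord ε A B l) -
        tang H (ε * Complex.I * tangCoord ε A B l) * kf (Complex.I * A) (Complex.I * B) 0 l +
        tang H w₂) 0 0).im = -ε * (4 / H * ‖tangCoord ε A B l‖ ^ 2) := by
  have hl := star_circle l
  have hl0 := Circle.coe_ne_zero l
  rw [← Complex.add_im]
  have : ∀ X : ℂ, X = Complex.I * (-ε * (4 / H * ‖tangCoord ε A B l‖ ^ 2) : ℝ) →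
      X.im = -ε * (4 / H * ‖tangCoord ε A B l‖ ^ 2) := fun X hX => by
    rw [hX, Complex.I_mul_im, Complex.ofReal_re]
  apply this
  push_cast
  rw [← Complex.mul_conj']
  rcases hε with rfl | rfl
  · simp [tang, tangCoord, kf_eq, hl]
    field_simp
    ring_nf
    simp only [Complex.I_sq]
    ring
  · have : ¬ ((-1 : ℝ) = 1) := by norm_num
    simp [tang, tangCoord, kf_eq, hl, this]
    field_simp
    ring_nf
    simp only [Complex.I_sq]
    ring

lemma MDeriv.real_smul {f : ℝ → M2} {f' : M2} {t : ℝ} (hf : MDeriv f f' t) (r : ℝ) :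
    MDeriv (fun s => r • f s) (r • f') t :=
  fun i j => (hf i j).const_smul r

lemma MSmooth.real_smul {E : Type*} [NormedAddCommGroup E] [NormedSpace ℝ E] {f : E → M2}
    (hf : MSmooth f) (r : ℝ) : MSmooth fun x => r • f x :=
  fun i j => (hf i j).const_smul r

lemma mderiv_tang (H : ℝ) {w : ℝ → ℂ} {w' : ℂ} {t : ℝ} (hw : HasDerivAt w w' t) :
    MDeriv (fun s => tang H (w s)) (tang H w') t := by
  intro i j
  fin_cases i <;> fin_cases j
  · exact hasDerivAt_const _ _
  · exact hw.star.const_mul _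
  · exact hw.const_mul _
  · exact hasDerivAt_const _ _

lemma tangCoord_contDiff (ε : ℝ) {A B : ℂ → ℂ} (hA : ContDiff ℝ ∞ A) (hB : ContDiff ℝ ∞ B) (l : ℂ) :
    ContDiff ℝ ∞ fun z => tangCoord ε (A z) (B z) l := by
  unfold tangCoord
  split_ifs
  · exact contDiff_const.mul hB
  · exact contDiff_const.mul (Complex.conjCLE.contDiff.comp hA)

lemma msmooth_tang (H : ℝ) {w : ℂ → ℂ} (hw : ContDiff ℝ ∞ w) : MSmooth fun z => tang H (w z) := by
  intro i j
  fin_cases i <;> fin_cases j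
  · exact contDiff_const
  · exact contDiff_const.mul (Complex.conjCLE.contDiff.comp hw)
  · exact contDiff_const.mul hw
  · exact contDiff_const

/-! ### Derivatives and fundamental forms of the surfaces -/

section

variable {a b : ℂ} {c : ℝ} {d : LaxData a b c} (f : d.PlusFlow)

namespace LaxData.PlusFlow

lemma frame_inv (z : ℂ) (l : Circle) : (f.frame z l)⁻¹ = (f.frame z l).adjugate := by
  refine Matrix.inv_eq_right_inv ?_
  rw [Matrix.mul_adjugate, f.det_frame (Circle.coe_ne_zero l), one_smul]

lemma msmooth_frame (l : Circle) : MSmooth fun z => f.frame z l := by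
  obtain ⟨t, rfl⟩ := Circle.exp_surjective l
  exact f.frame_msmooth.comp (contDiff_id.prodMk contDiff_const)

lemma msmooth_frame_inv (l : Circle) : MSmooth fun z => (f.frame z l)⁻¹ := by
  simp only [f.frame_inv]
  exact (f.msmooth_frame l).adjugate

lemma msmooth_frame_mul_exp (l : Circle) :
    MSmooth fun q : ℂ × ℝ => f.frame q.1 (l * Circle.exp q.2 : Circle) := by
  obtain ⟨t, rfl⟩ := Circle.exp_surjective l
  have h : ContDiff ℝ ∞ fun q : ℂ × ℝ => (q.1, t + q.2) :=
    contDiff_fst.prodMk (contDiff_const.add contDiff_snd)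
  simpa only [Circle.exp_add] using f.frame_msmooth.comp h

lemma msmooth_loopDeriv (l : Circle) :
    MSmooth fun z => loopDeriv (fun l : Circle => f.frame z l) l := by
  intro i j
  have hQ := f.msmooth_frame_mul_exp l i j
  have h1 : ∀ z : ℂ, loopDeriv (fun l : Circle => f.frame z l) l i j =
      fderiv ℝ (fun q : ℂ × ℝ => f.frame q.1 (l * Circle.exp q.2 : Circle) i j) (z, 0) (0, 1) :=
    fun z => ((hQ.differentiable (by simp) (z, 0)).hasFDerivAt.comp_hasDerivAt (0 : ℝ)
      ((hasDerivAt_const (0 : ℝ) z).prodMk (hasDerivAt_id (0 : ℝ)))).deriv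
  rw [funext h1]
  exact ((hQ.fderiv_right (m := ∞) le_rfl).comp (contDiff_id.prodMk contDiff_const)).clm_apply
    contDiff_const

lemma msmooth_symBobenko (H ε : ℝ) (l : Circle) :
    MSmooth (symBobenko H ε (fun z (l : Circle) => f.frame z l) l) :=
  ((((f.msmooth_frame l).mul (msmooth_const ((-ε) • e1))).mul (f.msmooth_frame_inv l)).add
    ((f.msmooth_loopDeriv l).mul (f.msmooth_frame_inv l))).real_smul _

section

variable {z v A B : ℂ} {e : ℝ}

lemma mderiv_frame_inv {X : M2} {l : Circle} (hX : X.trace = 0)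
    (hv : MDeriv (fun r : ℝ => f.frame (z + r * v) l) (f.frame z l * X) 0) :
    MDeriv (fun r : ℝ => (f.frame (z + r * v) l)⁻¹) (-(X * (f.frame z l)⁻¹)) 0 := by
  simp only [f.frame_inv]
  refine hv.adjugate.congr_deriv ?_
  rw [Matrix.adjugate_mul_distrib, adjugate_eq_neg hX, neg_mul]

lemma mderiv_conj {X Y Y' : M2} {y : ℝ → M2} {l : Circle} (hX : X.trace = 0)
    (hv : MDeriv (fun r : ℝ => f.frame (z + r * v) l) (f.frame z l * X) 0) (hy : MDeriv y Y' 0)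
    (hY : y 0 = Y) : MDeriv (fun r : ℝ => f.frame (z + r * v) l * y r * (f.frame (z + r * v) l)⁻¹)
      (f.frame z l * (X * Y - Y * X + Y') * (f.frame z l)⁻¹) 0 := by
  refine ((hv.mul hy).mul (f.mderiv_frame_inv hX hv)).congr_deriv ?_
  rw [hY]
  simp only [Complex.ofReal_zero, zero_mul, add_zero]
  noncomm_ring

lemma mderiv_symBobenko {H ε : ℝ} (hH : H ≠ 0) (hε : ε ∈ ({1, -1} : Set ℝ)) (l : Circle)
    (hv : ∀ l : Circle, MDeriv (fun r : ℝ => f.frame (z + r * v) l)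
      (f.frame z l * kf A B e l) 0) :
    MDeriv (fun r : ℝ => symBobenko H ε (fun z (l : Circle) => f.frame z l) l (z + r * v))
      (f.frame z l * tang H (tangCoord ε A B l) * (f.frame z l)⁻¹) 0 := by
  -- Exchanging the derivatives gives `(F')_v = (FX)' = F'X + FX'`, which needs `hv` for all `l`. In
  -- the derivative of `F' F⁻¹` the term with `F'X` cancels and `Ad F X'` remains.
  have h1 : MDeriv (fun r : ℝ => loopDeriv (fun l : Circle => f.frame (z + r * v) l) l)
      (loopDeriv (fun l : Circle => f.frame z l * kf A B e l) l) 0 := fun i j =>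
    hasDerivAt_deriv_snd (f.msmooth_frame_mul_exp l i j) fun t => hv (l * Circle.exp t) i j
  have h2 : loopDeriv (fun l : Circle => f.frame z l * kf A B e l) l =
      loopDeriv (fun l : Circle => f.frame z l) l * kf A B e l + f.frame z l *
      ((-(Complex.I * (l : ℂ)⁻¹)) • offd A B - (Complex.I * l) • (offd A B).conjTranspose) :=
    loopDeriv_eq ((((f.frame_inLoop z).smooth.mderiv_loopDeriv l).mul
      (mderiv_kf A B e l)).congr_deriv (by simp))
  rw [h2] at h1
  have h3 := f.mderiv_conj (trace_kf A B e l) (hv l) (mderiv_const ((-ε) • e1)) rfl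
  have h4 := h1.mul (f.mderiv_frame_inv (trace_kf A B e l) (hv l))
  refine ((h3.add h4).real_smul (-(1 / (2 * H)))).congr_deriv ?_
  rw [← tang_eq hH hε A B e l, mul_smul_comm, smul_mul_assoc]
  simp only [Complex.ofReal_zero, zero_mul, add_zero]
  noncomm_ring

end

section

variable {H ε : ℝ} (hH : H ≠ 0) (hε : ε ∈ ({1, -1} : Set ℝ)) (l : Circle)

/-- The coordinate of `∂f/∂x` in the moving frame. -/
def coord (_ : d.PlusFlow) (ε : ℝ) (l : Circle) (z : ℂ) : ℂ :=
  tangCoord ε (d.α z.im) (d.β z.im) l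

lemma contDiff_coord (ε : ℝ) (l : Circle) : ContDiff ℝ ∞ (f.coord ε l) :=
  tangCoord_contDiff ε (d.smooth_α.comp Complex.imCLM.contDiff)
    (d.smooth_β.comp Complex.imCLM.contDiff) l

include hH hε

lemma dx_surface : dx (surface H ε (fun z (l : Circle) => f.frame z l) l) =
    fun z => toE3 (f.frame z l * tang H (f.coord ε l z) * (f.frame z l)⁻¹) :=
  funext fun z => fderiv_toE3 (f.msmooth_symBobenko H ε l)
    (f.mderiv_symBobenko hH hε l fun l => f.mderiv_frame_x (Circle.coe_ne_zero l) z)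

lemma dy_surface : dy (surface H ε (fun z (l : Circle) => f.frame z l) l) =
    fun z => toE3 (f.frame z l * tang H (ε * Complex.I * f.coord ε l z) * (f.frame z l)⁻¹) := by
  funext z
  have := fderiv_toE3 (f.msmooth_symBobenko H ε l) (v := Complex.I)
    (f.mderiv_symBobenko hH hε l fun l => f.mderiv_frame_y (Circle.coe_ne_zero l) z)
  rwa [tangCoord_I hε] at this

omit hH hε in
lemma fderiv_conj_tang {w : ℂ → ℂ} (hw : ContDiff ℝ ∞ w) {z v : ℂ} {X : M2} (hX : X.trace = 0)
    (hv : MDeriv (fun r : ℝ => f.frame (z + r * v) l) (f.frame z l * X) 0) :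
    fderiv ℝ (fun z => toE3 (f.frame z l * tang H (w z) * (f.frame z l)⁻¹)) z v =
      toE3 (f.frame z l * (X * tang H (w z) - tang H (w z) * X + tang H (fderiv ℝ w z v)) *
        (f.frame z l)⁻¹) :=
  fderiv_toE3 (((f.msmooth_frame l).mul (msmooth_tang H hw)).mul (f.msmooth_frame_inv l))
    (f.mderiv_conj hX hv (mderiv_tang H (hasDerivAt_line
      (hw.differentiable (by simp) z).hasFDerivAt)) (by simp))

lemma inner_dx_dx (z : ℂ) : inner ℝ (dx (surface H ε (fun z (l : Circle) => f.frame z l) l) z)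
    (dx (surface H ε (fun z (l : Circle) => f.frame z l) l) z) =
      4 / H ^ 2 * ‖f.coord ε l z‖ ^ 2 := by
  rw [f.dx_surface hH hε, inner_toE3_conj (inSu2_tang _ _) (inSu2_tang _ _)
    (f.frame_mul_conjTranspose z l), inner_tang, RCLike.star_def, Complex.mul_conj']
  norm_cast

lemma inner_dy_dy (z : ℂ) : inner ℝ (dy (surface H ε (fun z (l : Circle) => f.frame z l) l) z)
    (dy (surface H ε (fun z (l : Circle) => f.frame z l) l) z) =
      4 / H ^ 2 * ‖f.coord ε l z‖ ^ 2 := by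
  have hn : ‖(ε * Complex.I * f.coord ε l z : ℂ)‖ = ‖f.coord ε l z‖ := by
    rcases hε with rfl | rfl <;> simp
  rw [f.dy_surface hH hε, inner_toE3_conj (inSu2_tang _ _) (inSu2_tang _ _)
    (f.frame_mul_conjTranspose z l), inner_tang, RCLike.star_def, Complex.mul_conj', hn]
  norm_cast

lemma inner_dx_dy (z : ℂ) : inner ℝ (dx (surface H ε (fun z (l : Circle) => f.frame z l) l) z)
    (dy (surface H ε (fun z (l : Circle) => f.frame z l) l) z) = 0 := by
  rw [f.dx_surface hH hε, f.dy_surface hH hε, inner_toE3_conj (inSu2_tang _ _) (inSu2_tang _ _)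
    (f.frame_mul_conjTranspose z l), inner_tang]
  simp
  right
  ring

lemma isConformalMap_surface :
    IsConformalMap (surface H ε (fun z (l : Circle) => f.frame z l) l) := by
  refine fun z => ⟨?_, f.inner_dx_dy hH hε l z⟩
  rw [← pow_left_inj₀ (norm_nonneg _) (norm_nonneg _) two_ne_zero, ← real_inner_self_eq_norm_sq,
    ← real_inner_self_eq_norm_sq, f.inner_dx_dx hH hε, f.inner_dy_dy hH hε]

lemma isSmoothImmersion_surface (hw : ∀ z, f.coord ε l z ≠ 0) :
    IsSmoothImmersion (surface H ε (fun z (l : Circle) => f.frame z l) l) := by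
  refine ⟨toE3_contDiff (f.msmooth_symBobenko H ε l), fun z => ?_⟩
  rw [injective_iff_map_eq_zero]
  intro v hv
  have hE : 4 / H ^ 2 * ‖f.coord ε l z‖ ^ 2 ≠ 0 := by
    have := norm_ne_zero_iff.2 (hw z)
    positivity
  have hv' : v = v.re • (1 : ℂ) + v.im • Complex.I := by simp [Complex.re_add_im]
  rw [hv', map_add, map_smul, map_smul] at hv
  change v.re • dx _ z + v.im • dy _ z = 0 at hv
  have h1 := congrArg (inner ℝ (dx (surface H ε (fun z (l : Circle) => f.frame z l) l) z)) hv
  have h2 := congrArg (inner ℝ (dy (surface H ε (fun z (l : Circle) => f.frame z l) l) z)) hv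
  rw [inner_add_right, inner_smul_right, inner_smul_right, inner_zero_right,
    f.inner_dx_dx hH hε, f.inner_dx_dy hH hε] at h1
  rw [inner_add_right, inner_smul_right, inner_smul_right, inner_zero_right,
    f.inner_dy_dy hH hε, real_inner_comm, f.inner_dx_dy hH hε] at h2
  apply Complex.ext
  · simpa [hE] using h1
  · simpa [hE] using h2

/-- In conformal coordinates the equation reduces to `⟨f_xx + f_yy, ν⟩ = 2H ‖f_x‖²`, with `‖f_x‖² =
4|w|²/H²` for the coordinate `w` of `f_x`. The sign in `ν = -ε Ad F e1` makes the mean curvature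
`H`, not `-H`, in both families. -/
lemma hasConstantMeanCurvature_surface :
    HasConstantMeanCurvature H (surface H ε (fun z (l : Circle) => f.frame z l) l) := by
  have hε2 : ε * ε = 1 := by rcases hε with rfl | rfl <;> norm_num
  have hN : MSmooth fun z => f.frame z l * e1 * (f.frame z l)⁻¹ :=
    ((f.msmooth_frame l).mul (msmooth_const e1)).mul (f.msmooth_frame_inv l)
  have htan : ∀ (z w : ℂ), inner ℝ ((-ε) • toE3 (f.frame z l * e1 * (f.frame z l)⁻¹))
      (toE3 (f.frame z l * tang H w * (f.frame z l)⁻¹)) = 0 := fun z w => by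
    rw [inner_smul_left, real_inner_comm, inner_toE3_conj (inSu2_tang _ _) inSu2_e1
      (f.frame_mul_conjTranspose z l), inner_toE3_e1]
    simp [tang]
  have hnor : ∀ (z : ℂ) {X : M2}, InSu2 X → inner ℝ (toE3 (f.frame z l * X * (f.frame z l)⁻¹))
      ((-ε) • toE3 (f.frame z l * e1 * (f.frame z l)⁻¹)) = -ε * (2 * (X 0 0).im) := fun z X hX => by
    rw [inner_smul_right, inner_toE3_conj hX inSu2_e1 (f.frame_mul_conjTranspose z l),
      inner_toE3_e1]
  refine ⟨fun z => (-ε) • toE3 (f.frame z l * e1 * (f.frame z l)⁻¹),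
    (toE3_contDiff hN).const_smul _, fun z => ⟨?_, ?_, ?_, ?_⟩⟩
  · have h1 : ‖toE3 (f.frame z l * e1 * (f.frame z l)⁻¹)‖ ^ 2 = 1 := by
      rw [← real_inner_self_eq_norm_sq, inner_toE3_conj inSu2_e1 inSu2_e1
        (f.frame_mul_conjTranspose z l), inner_toE3_e1]
      simp [e1]
    have h2 : |ε| = 1 := by rcases hε with rfl | rfl <;> simp
    rw [norm_smul, norm_neg, Real.norm_eq_abs, h2, one_mul]
    exact (pow_eq_one_iff_of_nonneg (norm_nonneg _) two_ne_zero).1 h1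
  · rw [f.dx_surface hH hε]; exact htan z _
  · rw [f.dy_surface hH hε]; exact htan z _
  · have hxx := f.fderiv_conj_tang (H := H) l (f.contDiff_coord ε l) (trace_kf _ _ _ _)
      (f.mderiv_frame_x (Circle.coe_ne_zero l) z)
    have hyy := f.fderiv_conj_tang (H := H) l
      (contDiff_const.mul (f.contDiff_coord ε l) : ContDiff ℝ ∞ fun z => ε * Complex.I * f.coord ε l z)
      (trace_kf _ _ _ _) (f.mderiv_frame_y (Circle.coe_ne_zero l) z)
    have hs := commutator_tang_add (H := H) hε (d.α z.im) (d.β z.im) (d.γ z.im) l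
      (fderiv ℝ (f.coord ε l) z 1) (fderiv ℝ (fun z => ε * Complex.I * f.coord ε l z) z Complex.I)
    rw [f.inner_dx_dx hH hε, f.inner_dx_dy hH hε, f.inner_dy_dy hH hε, f.dx_surface hH hε,
      f.dy_surface hH hε]
    rw [dx, dy, dy, hxx, hyy, hnor z (((inSu2_kf _ _ _ l).commutator (inSu2_tang _ _)).add
      (inSu2_tang _ _)), hnor z (((inSu2_kf _ _ _ l).commutator (inSu2_tang _ _)).add
      (inSu2_tang _ _)), mul_zero, sub_zero, ← add_mul, ← mul_add, ← mul_add]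
    erw [hs]
    change -ε * (2 * (-ε * (4 / H * ‖f.coord ε l z‖ ^ 2))) * _ = _
    have : -ε * (2 * (-ε * (4 / H * ‖f.coord ε l z‖ ^ 2))) = 8 / H * ‖f.coord ε l z‖ ^ 2 := by
      linear_combination (8 / H * ‖f.coord ε l z‖ ^ 2) * hε2
    rw [this]
    field_simp
    ring

lemma isCMCSurface_surface (hw : ∀ z, f.coord ε l z ≠ 0) :
    IsCMCSurface H (surface H ε (fun z (l : Circle) => f.frame z l) l) :=
  ⟨f.isSmoothImmersion_surface hH hε l hw, f.hasConstantMeanCurvature_surface hH hε l⟩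

lemma surface_const (hw : ∀ z, f.coord ε l z = 0) (z : ℂ) :
    surface H ε (fun z (l : Circle) => f.frame z l) l z =
      surface H ε (fun z (l : Circle) => f.frame z l) l 0 := by
  refine is_const_of_fderiv_eq_zero (𝕜 := ℝ)
    ((toE3_contDiff (f.msmooth_symBobenko H ε l)).differentiable (by simp)) (fun z => ?_) z 0
  have h0 : toE3 (f.frame z l * tang H 0 * (f.frame z l)⁻¹) = 0 := by
    have : tang H 0 = 0 := by ext i j; fin_cases i <;> fin_cases j <;> simp [tang]
    rw [this]
    ext i
    fin_cases i <;> simp [toE3]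
  have h1 := congrFun (f.dx_surface hH hε l) z
  have h2 := congrFun (f.dy_surface hH hε l) z
  simp only [hw, mul_zero, h0] at h1 h2
  ext1 v
  have hv : v = v.re • (1 : ℂ) + v.im • Complex.I := by simp [Complex.re_add_im]
  rw [hv, map_add, map_smul, map_smul]
  change v.re • dx (surface H ε (fun z (l : Circle) => f.frame z l) l) z +
    v.im • dy (surface H ε (fun z (l : Circle) => f.frame z l) l) z = 0
  rw [h1, h2, smul_zero, smul_zero, add_zero]

end

end LaxData.PlusFlow

end

/-! ### The special points on the circle -/

lemma exists_circle_I : ∃ i : Circle, (i : ℂ) = Complex.I :=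
  ⟨⟨Complex.I, by simp [Submonoid.unitSphere]⟩, rfl⟩

lemma fourth_roots {r : ℂ} (hr : ‖r‖ = 1) : ∃ m i : Circle, (i : ℂ) = Complex.I ∧
    {m : Circle | (m : ℂ) ^ 4 = r} = {m, -m, i * m, -(i * m)} ∧
    {m : Circle | (m : ℂ) ^ 4 = r}.ncard = 4 := by
  obtain ⟨i, hi⟩ := exists_circle_I
  obtain ⟨t, ht⟩ := Circle.exp_surjective ⟨r, by simpa [Submonoid.unitSphere] using hr⟩
  have ht' : (Circle.exp t : ℂ) = r := by rw [ht]
  obtain ⟨m, hm⟩ : ∃ m, m = Circle.exp (t / 4) := ⟨_, rfl⟩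
  have hm4 : (m : ℂ) ^ 4 = r := by
    rw [← ht', hm]
    simp only [Circle.coe_exp]
    rw [← Complex.exp_nat_mul]
    congr 1
    push_cast
    ring
  have hneg : ∀ l : Circle, ((-l : Circle) : ℂ) = -(l : ℂ) := fun l => rfl
  have hm0 := Circle.coe_ne_zero m
  have hset : {m : Circle | (m : ℂ) ^ 4 = r} = {m, -m, i * m, -(i * m)} := by
    ext l
    simp only [Set.mem_ofPred_eq, Set.mem_insert_iff, Set.mem_singleton_iff, ← Circle.coe_inj,
      hneg, Circle.coe_mul, hi]
    constructor
    · intro h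
      have h1 : ((l : ℂ) - m) * (l + m) * ((l - Complex.I * m) * (l + Complex.I * m)) = 0 := by
        linear_combination h - hm4 + (l ^ 2 * m ^ 2 * (-1) + m ^ 4) * Complex.I_sq
      rcases mul_eq_zero.1 h1 with h | h <;> rcases mul_eq_zero.1 h with h | h
      · exact .inl (sub_eq_zero.1 h)
      · exact .inr (.inl (eq_neg_of_add_eq_zero_left h))
      · exact .inr (.inr (.inl (sub_eq_zero.1 h)))
      · exact .inr (.inr (.inr (eq_neg_of_add_eq_zero_left h)))
    · have hI4 : Complex.I ^ 4 = 1 := by simp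
      rintro (h | h | h | h) <;> rw [h]
      · exact hm4
      · linear_combination hm4
      · linear_combination hm4 + m ^ 4 * hI4
      · linear_combination hm4 + m ^ 4 * hI4
  refine ⟨m, i, hi, hset, ?_⟩
  have hc : ∀ x y : ℂ, x ≠ y → x * m ≠ y * m := fun x y h => by simpa [hm0] using h
  have h1 : m ≠ -m := fun h => hc 1 (-1) (by norm_num) (by simpa [hneg] using congrArg (fun l : Circle => (l : ℂ)) h)
  have h2 : m ≠ i * m := fun h => hc 1 Complex.I
    (fun h => by simpa using congrArg Complex.re h) (by simpa [hi] using congrArg (fun l : Circle => (l : ℂ)) h)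
  have h3 : m ≠ -(i * m) := fun h => hc 1 (-Complex.I)
    (fun h => by simpa using congrArg Complex.re h)
    (by simpa [hi, hneg] using congrArg (fun l : Circle => (l : ℂ)) h)
  have h4 : -m ≠ i * m := fun h => hc (-1) Complex.I
    (fun h => by simpa using congrArg Complex.re h)
    (by simpa [hi, hneg] using congrArg (fun l : Circle => (l : ℂ)) h)
  have h5 : -m ≠ -(i * m) := fun h => h2 (neg_injective h)
  have h6 : i * m ≠ -(i * m) := fun h => hc Complex.I (-Complex.I)
    (fun h => by have := congrArg Complex.im h; norm_num at this)
    (by simpa [hi, hneg] using congrArg (fun l : Circle => (l : ℂ)) h)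
  rw [hset, Set.ncard_insert_of_notMem (by simp [h1, h2, h3]),
    Set.ncard_insert_of_notMem (by simp [h4, h5]), Set.ncard_pair h6]

section

variable {a b : ℂ} {c : ℝ}

/-- Twisting makes the zeros of `ξ` come in antipodal pairs, and `ξ` cannot vanish at both `m` and
`im`, for that would give `a = m² b̄ = -m² b̄`. -/
lemma two_le_ncard_ne_zero (ha : a ≠ 0) {r : ℂ} (hr : ‖r‖ = 1) :
    2 ≤ {m : Circle | (m : ℂ) ^ 4 = r ∧ kf a b c m ≠ 0}.ncard := by
  obtain ⟨m, i, hi, hset, hcard⟩ := fourth_roots hr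
  have hneg : ∀ l : Circle, ((-l : Circle) : ℂ) = -(l : ℂ) := fun l => rfl
  have hfin' : {m : Circle | (m : ℂ) ^ 4 = r}.Finite :=
    Set.finite_of_ncard_ne_zero (by rw [hcard]; norm_num)
  have hfin : {m : Circle | (m : ℂ) ^ 4 = r ∧ kf a b c m ≠ 0}.Finite :=
    hfin'.subset fun l hl => hl.1
  have key : ∀ l : Circle, (l : ℂ) ^ 4 = r → kf a b c l ≠ 0 →
      2 ≤ {m : Circle | (m : ℂ) ^ 4 = r ∧ kf a b c m ≠ 0}.ncard := by
    intro l hl h0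
    have hne : l ≠ -l := fun h => by
      have h' : (l : ℂ) = -l := congrArg (fun l : Circle => (l : ℂ)) h
      exact Circle.coe_ne_zero l (by linear_combination h' / 2)
    refine (Set.ncard_pair hne).symm.le.trans (Set.ncard_le_ncard ?_ hfin)
    rintro x (rfl | rfl)
    · exact ⟨hl, h0⟩
    · refine ⟨by rw [hneg, ← hl]; ring, fun h => h0 ?_⟩
      rw [hneg, ← tau_kf] at h
      rw [← tau_tau (kf a b c l), h]
      simp [tau]
  have hm : (m : ℂ) ^ 4 = r := by
    have : m ∈ {m : Circle | (m : ℂ) ^ 4 = r} := by rw [hset]; simp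
    exact this
  have him : ((i * m : Circle) : ℂ) ^ 4 = r := by
    have : i * m ∈ {m : Circle | (m : ℂ) ^ 4 = r} := by rw [hset]; simp
    exact this
  by_cases h0 : kf a b c m = 0
  · refine key _ him fun h => ha ?_
    have e1 := congrFun (congrFun h0 0) 1
    have e2 := congrFun (congrFun h 0) 1
    rw [kf_eq] at e1 e2
    have hm0 := Circle.coe_ne_zero m
    simp [hi] at e1 e2
    field_simp at e1 e2
    have e3 : -a - (m : ℂ) ^ 2 * (starRingEnd ℂ) b = 0 :=
      mul_left_cancel₀ Complex.I_ne_zero (by linear_combination e2)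
    linear_combination e1 / 2 - e3 / 2
  · exact key _ hm h0

lemma offd_zero : offd 0 0 = 0 := by
  ext i j
  fin_cases i <;> fin_cases j <;> rfl

lemma kf_ne_zero_of_mul_eq_zero (h : offd a b ≠ 0) (hab : a * b = 0) (l : Circle) :
    kf a b c l ≠ 0 := fun h0 => h <| by
  have hl := Circle.coe_ne_zero l
  rw [kf_eq] at h0
  have e1 := congrFun (congrFun h0 0) 1
  have e2 := congrFun (congrFun h0 1) 0
  rcases mul_eq_zero.1 hab with rfl | rfl <;> simp [hl] at e1 e2
  · rw [e1, offd_zero]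
  · rw [e2, offd_zero]

lemma norm_div_star {w : ℂ} (hw : w ≠ 0) : ‖w / star w‖ = 1 := by
  rw [norm_div, norm_star, div_self (norm_ne_zero_iff.2 hw)]

/-- A zero of `ξ` on the circle forces `c = 0` and `|a| = |b|`. The energy is then at its minimum:
it reads `γ² = -|a|² (exp (-2u) - exp (2u))²`. -/
lemma LaxData.γ_eq_zero (d : LaxData a b c) {l : Circle} (ha : a ≠ 0) (h0 : kf a b c l = 0) (y : ℝ) : d.γ y = 0 := by
  have hl := Circle.coe_ne_zero l
  rw [kf_eq] at h0
  have e0 := congrFun (congrFun h0 0) 0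
  have e1 := congrFun (congrFun h0 0) 1
  simp at e0 e1
  have hab : ‖a‖ = ‖b‖ := by
    have := congrArg norm (sub_eq_zero.1 e1)
    simpa [Circle.norm_coe] using this
  have he := d.energy y
  have hc2 : c ^ 2 = 0 := by rw [e0]; norm_num
  rw [hc2, d.α_eq, d.β_eq, norm_mul, norm_mul, Complex.norm_real, Complex.norm_real,
    Real.norm_of_nonneg (Real.exp_pos _).le, Real.norm_of_nonneg (Real.exp_pos _).le, ← hab] at he
  have h1 : Real.exp (-2 * d.u y) * Real.exp (2 * d.u y) = 1 := by
    rw [← Real.exp_add]; simp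
  have h2 : d.γ y ^ 2 = -(‖a‖ ^ 2 * (Real.exp (-2 * d.u y) - Real.exp (2 * d.u y)) ^ 2) := by
    linear_combination he - 2 * ‖a‖ ^ 2 * h1
  have h3 : d.γ y ^ 2 ≤ 0 := by rw [h2]; exact neg_nonpos.2 (by positivity)
  exact pow_eq_zero_iff two_ne_zero |>.1 (le_antisymm h3 (sq_nonneg _))

variable {d : LaxData a b c} (f : d.PlusFlow)

namespace LaxData.PlusFlow

/-! ### Delaunay surfaces -/

lemma frame_add_real (z : ℂ) (x : ℝ) (l : ℂ) :
    f.frame (z + x) l = NormedSpace.exp ((x : ℂ) • kf a b c l) * f.frame z l := by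
  rw [frame, frame, ← mul_assoc, ← Matrix.exp_add_of_commute, ← add_smul, add_comm z]
  · simp
  · exact ((Commute.refl _).smul_left _).smul_right _

lemma isSurfaceOfRevolution_surface {H : ℝ} (hH : H ≠ 0) (ε : ℝ) {m : Circle}
    (h : (m : ℂ) ^ 4 * star (a * b) = a * b) (h0 : kf a b c m ≠ 0) :
    IsSurfaceOfRevolution (surface H ε (fun z (l : Circle) => f.frame z l) m) := by
  refine isSurfaceOfRevolution_of_symmetry (actsByRotations_kf h h0) hH
    (inSu2_symBobenko f.frame_inLoop H ε m) 1 fun x z => ?_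
  refine symBobenko_of_eq_mul f.frame_inLoop (smoothLoop_expLoop a b c x) ?_ hH ε m
  funext l
  rw [mul_one, f.frame_add_real]
  rfl

/-- If `ξ` vanishes at a point of the circle, the surfaces have a second symmetry. -/
lemma frame_add_imaginary {l₀ : Circle} (ha : a ≠ 0) (h0 : kf a b c l₀ = 0) (z : ℂ) (y : ℝ)
    {l : ℂ} (hl : l ≠ 0) : f.frame (z + y * Complex.I) l =
      NormedSpace.exp ((y : ℂ) • kf (Complex.I * a) (Complex.I * b) 0 l) * f.frame z l := by
  have hγ := d.γ_eq_zero ha h0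
  have hu : ∀ y, d.u y = 0 := fun y => by
    have h : ∀ y, HasDerivAt d.u 0 y := fun y => hγ y ▸ d.deriv_u y
    rw [is_const_of_deriv_eq_zero (fun y => (h y).differentiableAt) (fun y => (h y).deriv) y 0,
      d.zero.1]
  have hα : ∀ y, d.α y = a := fun y => by rw [d.α_eq, hu]; simp
  have hβ : ∀ y, d.β y = b := fun y => by rw [d.β_eq, hu]; simp
  set T := kf (Complex.I * a) (Complex.I * b) 0 l with hT
  have htheta : ∀ y, d.theta y l = T := fun y => by rw [LaxData.theta, hα, hβ]
  have heta : ∀ y, d.eta y l = kf a b c l := fun y => by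
    rw [← d.eta_zero, LaxData.eta, LaxData.eta, hα, hβ, hγ, hα, hβ, hγ]
  -- For constant `η = ξ` the Lax equation says `[iξ - θ, ξ] = 0`.
  have hcomm : Commute (kf a b c l) T := by
    have h1 := d.mderiv_eta hl 0
    simp only [heta] at h1
    have h2 := h1.unique (mderiv_const _)
    rw [d.plus_eq, htheta, heta, sub_mul, mul_sub, smul_mul_assoc, mul_smul_comm] at h2
    have h3 : kf a b c l * T - T * kf a b c l = 0 := by rw [← h2]; abel
    exact sub_eq_zero.1 h3
  have himag : ∀ y : ℝ, f.frame (y * Complex.I) l = NormedSpace.exp ((y : ℂ) • T) := fun y => by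
    have h1 : ∀ t : ℝ, MDeriv (fun t : ℝ => f.frame (t * Complex.I) l)
        (f.frame (t * Complex.I) l * T) t := fun t => by
      have := mderiv_line (G := fun z => f.frame z l) (X := fun z => f.frame z l * d.theta z.im l)
        (f.mderiv_frame_y hl) 0 t
      simpa only [zero_add, htheta] using this
    have h2 : ∀ t, MDeriv (fun t : ℝ => f.frame (t * Complex.I) l *
        NormedSpace.exp ((t : ℂ) • (-T))) 0 t := fun t =>
      ((h1 t).mul (mderiv_exp_smul (-T) t)).congr_deriv (by noncomm_ring)
    have h3 := eq_of_mderiv_eq_zero h2 y 0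
    simp only [Complex.ofReal_zero, zero_mul, f.frame_zero, zero_smul, NormedSpace.exp_zero,
      mul_one] at h3
    have h4 : NormedSpace.exp ((y : ℂ) • (-T)) * NormedSpace.exp ((y : ℂ) • T) = 1 := by
      rw [← Matrix.exp_add_of_commute]
      · simp
      · exact (((Commute.refl T).neg_left).smul_left _).smul_right _
    rw [← mul_one (f.frame (y * Complex.I) l), ← h4, ← mul_assoc, h3, one_mul]
  have hz : ∀ w : ℂ, f.frame w l =
      NormedSpace.exp ((w.re : ℂ) • kf a b c l) * NormedSpace.exp ((w.im : ℂ) • T) := fun w => by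
    rw [← himag, ← f.frame_add_real, add_comm, Complex.re_add_im]
  have hre : (z + y * Complex.I).re = z.re := by simp
  have him : (z + y * Complex.I).im = y + z.im := by simp [add_comm]
  have hc : Commute (NormedSpace.exp ((z.re : ℂ) • kf a b c l)) (NormedSpace.exp ((y : ℂ) • T)) :=
    ((hcomm.smul_left _).smul_right _).exp
  rw [hz, hz z, hre, him, Complex.ofReal_add, add_smul, Matrix.exp_add_of_commute, ← mul_assoc,
    hc.eq, mul_assoc]
  exact ((Commute.refl T).smul_left _).smul_right _

/-- The loop `θ` takes over the role of `ξ`. Replacing `a`, `b` by `ia`, `ib` only changes the sign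
of `ab`, so the quartic condition persists; and `θ` cannot vanish together with `ξ` at `m`, since
that would give `a = m² b̄ = -m² b̄`. -/
lemma isSurfaceOfRevolution_surface_of_eq_zero {H : ℝ} (hH : H ≠ 0) (ε : ℝ) {m : Circle}
    (ha : a ≠ 0) (h : (m : ℂ) ^ 4 * star (a * b) = a * b) (h0 : kf a b c m = 0) :
    IsSurfaceOfRevolution (surface H ε (fun z (l : Circle) => f.frame z l) m) := by
  have hm := Circle.coe_ne_zero m
  have h1 : kf (Complex.I * a) (Complex.I * b) 0 m ≠ 0 := fun h1 => by
    rw [kf_eq] at h0 h1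
    have e0 := congrFun (congrFun h0 0) 1
    have e1 := congrFun (congrFun h1 0) 1
    simp at e0 e1
    field_simp at e0 e1
    have e2 : a + (m : ℂ) ^ 2 * (starRingEnd ℂ) b = 0 :=
      mul_left_cancel₀ Complex.I_ne_zero (by linear_combination e1)
    exact ha (by linear_combination e0 / 2 + e2 / 2)
  have h2 : (m : ℂ) ^ 4 * star (Complex.I * a * (Complex.I * b)) =
      Complex.I * a * (Complex.I * b) := by
    simp only [star_mul', RCLike.star_def, Complex.conj_I] at h ⊢
    linear_combination Complex.I ^ 2 * h
  refine isSurfaceOfRevolution_of_symmetry (actsByRotations_kf h2 h1) hH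
    (inSu2_symBobenko f.frame_inLoop H ε m) Complex.I fun x z => ?_
  refine symBobenko_of_eq_mul f.frame_inLoop
    (smoothLoop_expLoop (Complex.I * a) (Complex.I * b) 0 x) ?_ hH ε m
  funext l
  exact f.frame_add_imaginary ha h0 z x (Circle.coe_ne_zero l)

lemma generates : Generates (fun l : Circle => kf a b c l) fun z (l : Circle) => f.frame z l :=
  fun z => ⟨f.frame_inLoop z, fun l => f.B (z.im, l), f.B_inLoopPlus z.im,
    fun l => (f.frame_mul_B z l).symm⟩

include f in
lemma coord_one_ne_zero (hb : b ≠ 0) (l : Circle) (z : ℂ) : f.coord 1 l z ≠ 0 := by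
  simp [coord, tangCoord, d.β_eq, hb]

include f in
lemma coord_neg_one_ne_zero (ha : a ≠ 0) (l : Circle) (z : ℂ) : f.coord (-1) l z ≠ 0 := by
  have : ¬ ((-1 : ℝ) = 1) := by norm_num
  simp [coord, tangCoord, d.α_eq, ha, this]

include f in
lemma coord_one_eq_zero (hb : b = 0) (l : Circle) (z : ℂ) : f.coord 1 l z = 0 := by
  simp [coord, tangCoord, d.β_eq, hb]

include f in
lemma coord_neg_one_eq_zero (ha : a = 0) (l : Circle) (z : ℂ) : f.coord (-1) l z = 0 := by
  have : ¬ ((-1 : ℝ) = 1) := by norm_num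
  simp [coord, tangCoord, d.α_eq, ha, this]

end LaxData.PlusFlow

end

end DegreeOnePotential

end

/-! ### Assembly of the theorem -/

theorem mainTheorem5 (xm x0 xp : DegreeOnePotential.M2)
    (hx : DegreeOnePotential.InLoopAlgebra (DegreeOnePotential.laurentLoop xm x0 xp))
    (hm : xm ≠ 0) :
    ∃ F : ℂ → Circle → DegreeOnePotential.M2,
      (DegreeOnePotential.Generates (DegreeOnePotential.laurentLoop xm x0 xp) F ∧
        ∀ F' : ℂ → Circle → DegreeOnePotential.M2,
          DegreeOnePotential.Generates (DegreeOnePotential.laurentLoop xm x0 xp) F' → F' = F) ∧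
      DegreeOnePotential.IsExtendedFrame F ∧
      -- every member of the associated families has the symmetry generated by `ξ`
      (∀ H : ℝ, H ≠ 0 → ∀ ε ∈ ({1, -1} : Set ℝ), ∀ (l : Circle) (x : ℝ) (z : ℂ),
        DegreeOnePotential.symBobenko H ε F l (z + x) =
          (-(1 / (2 * H))) • DegreeOnePotential.affineAct
            (DegreeOnePotential.Phi l
              (DegreeOnePotential.expLoop (DegreeOnePotential.laurentLoop xm x0 xp) x))
            ((-(2 * H)) • DegreeOnePotential.symBobenko H ε F l z)) ∧
      -- at the special points this symmetry is a pure rotation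
      (∀ m : Circle,
        (m : ℂ) ^ 4 * DegreeOnePotential.killing xp xp = DegreeOnePotential.killing xm xm →
        DegreeOnePotential.laurentLoop xm x0 xp m ≠ 0 →
        DegreeOnePotential.ActsByRotations (fun x : ℝ => DegreeOnePotential.Phi m
          (DegreeOnePotential.expLoop (DegreeOnePotential.laurentLoop xm x0 xp) x))) ∧
      -- the case in which both parallel surfaces are immersed
      (DegreeOnePotential.killing xm xm ≠ 0 →
        {m : Circle | (m : ℂ) ^ 4 = DegreeOnePotential.killing xm xm /
          DegreeOnePotential.killing xp xp}.ncard = 4 ∧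
        2 ≤ {m : Circle | (m : ℂ) ^ 4 = DegreeOnePotential.killing xm xm /
          DegreeOnePotential.killing xp xp ∧
          DegreeOnePotential.laurentLoop xm x0 xp m ≠ 0}.ncard ∧
        ∀ H : ℝ, H ≠ 0 → ∀ ε ∈ ({1, -1} : Set ℝ),
          (∀ l : Circle,
            DegreeOnePotential.IsCMCSurface H (DegreeOnePotential.surface H ε F l) ∧
            DegreeOnePotential.IsConformalMap (DegreeOnePotential.surface H ε F l)) ∧
          ∀ m : Circle, (m : ℂ) ^ 4 = DegreeOnePotential.killing xm xm /
              DegreeOnePotential.killing xp xp →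
            DegreeOnePotential.IsDelaunaySurface H (DegreeOnePotential.surface H ε F m)) ∧
      -- the case in which one of the parallel surfaces is a point
      (DegreeOnePotential.killing xm xm = 0 →
        ∃ ε ∈ ({1, -1} : Set ℝ), ∀ H : ℝ, H ≠ 0 → ∀ l : Circle,
          DegreeOnePotential.IsDelaunaySurface H (DegreeOnePotential.surface H ε F l) ∧
          DegreeOnePotential.IsConformalMap (DegreeOnePotential.surface H ε F l) ∧
          ∃ p : DegreeOnePotential.E3, ∀ z, DegreeOnePotential.surface H (-ε) F l z = p) := by
  obtain ⟨a, b, c, rfl, rfl, rfl⟩ := DegreeOnePotential.exists_kf_of_inLoopAlgebra hx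
  obtain ⟨d⟩ := DegreeOnePotential.nonempty_laxData a b c
  obtain ⟨f⟩ := d.nonempty_plusFlow
  rw [DegreeOnePotential.laurentLoop_eq_kf, DegreeOnePotential.killing_offd,
    DegreeOnePotential.killing_neg_conjTranspose]
  have hrot : ∀ m : Circle, (m : ℂ) ^ 4 * (8 * star (a * b)) = 8 * (a * b) →
      (m : ℂ) ^ 4 * star (a * b) = a * b := fun m h => by linear_combination h / 8
  refine ⟨fun z l => f.frame z l, ⟨f.generates, fun F' h => f.generates.unique h⟩,
    f.frame_isExtendedFrame, fun H hH ε _ l x z => ?_,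
    fun m h h0 => DegreeOnePotential.actsByRotations_kf (hrot m h) h0, fun hab => ?_,
    fun hab => ?_⟩
  · exact DegreeOnePotential.symBobenko_of_eq_mul f.frame_inLoop
      (DegreeOnePotential.smoothLoop_expLoop a b c x)
      (funext fun l => f.frame_add_real z x l) hH ε l
  · have hab' : a * b ≠ 0 := fun h => hab (by rw [h, mul_zero])
    have ha : a ≠ 0 := left_ne_zero_of_mul hab'
    have hb : b ≠ 0 := right_ne_zero_of_mul hab'
    have hr := DegreeOnePotential.norm_div_star hab'
    rw [mul_div_mul_left _ _ (by norm_num : (8 : ℂ) ≠ 0)]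
    obtain ⟨-, -, -, -, hcard⟩ := DegreeOnePotential.fourth_roots hr
    refine ⟨hcard, DegreeOnePotential.two_le_ncard_ne_zero ha hr, fun H hH ε hε => ?_⟩
    have hw : ∀ l z, f.coord ε l z ≠ 0 := by
      rcases hε with rfl | rfl
      · exact f.coord_one_ne_zero hb
      · exact f.coord_neg_one_ne_zero ha
    have hcmc := fun l => f.isCMCSurface_surface hH hε l (hw l)
    refine ⟨fun l => ⟨hcmc l, f.isConformalMap_surface hH hε l⟩, fun m h => ⟨hcmc m, ?_⟩⟩
    have h' : (m : ℂ) ^ 4 * star (a * b) = a * b := by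
      rw [h, div_mul_cancel₀ _ (star_ne_zero.2 hab')]
    by_cases h0 : DegreeOnePotential.kf a b c m = 0
    · exact f.isSurfaceOfRevolution_surface_of_eq_zero hH ε ha h' h0
    · exact f.isSurfaceOfRevolution_surface hH ε h' h0
  · have hab' : a * b = 0 := by simpa using hab
    -- When `ab = 0` the quartic condition reads `0 = 0`, and `ξ` has no zero on the circle, so
    -- every `λ` is a special point.
    have hrev : ∀ H : ℝ, H ≠ 0 → ∀ ε : ℝ, ∀ l : Circle, DegreeOnePotential.IsSurfaceOfRevolution
        (DegreeOnePotential.surface H ε (fun z (l : Circle) => f.frame z l) l) :=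
      fun H hH ε l => f.isSurfaceOfRevolution_surface hH ε (by rw [hab', star_zero, mul_zero])
        (DegreeOnePotential.kf_ne_zero_of_mul_eq_zero hm hab' l)
    rcases mul_eq_zero.1 hab' with ha | hb
    · have hb : b ≠ 0 := fun hb => hm (by rw [ha, hb]; exact DegreeOnePotential.offd_zero)
      have h1 : (1 : ℝ) ∈ ({1, -1} : Set ℝ) := by simp
      have h2 : (-1 : ℝ) ∈ ({1, -1} : Set ℝ) := by simp
      exact ⟨1, h1, fun H hH l =>
        ⟨⟨f.isCMCSurface_surface hH h1 l (f.coord_one_ne_zero hb l), hrev H hH 1 l⟩,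
          f.isConformalMap_surface hH h1 l, _,
          f.surface_const hH h2 l (f.coord_neg_one_eq_zero ha l)⟩⟩
    · have ha : a ≠ 0 := fun ha => hm (by rw [ha, hb]; exact DegreeOnePotential.offd_zero)
      have h1 : (1 : ℝ) ∈ ({1, -1} : Set ℝ) := by simp
      have h2 : (-1 : ℝ) ∈ ({1, -1} : Set ℝ) := by simp
      refine ⟨-1, h2, fun H hH l =>
        ⟨⟨f.isCMCSurface_surface hH h2 l (f.coord_neg_one_ne_zero ha l), hrev H hH (-1) l⟩,
          f.isConformalMap_surface hH h2 l,
          DegreeOnePotential.surface H 1 (fun z (l : Circle) => f.frame z l) l 0, ?_⟩⟩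
      rw [neg_neg]
      exact f.surface_const hH h1 l (f.coord_one_eq_zero hb l)
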